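/- Let $\mathcal D\subset\mathbb R^d$, $d\in\{2,3\}$, be a bounded Lipschitz domain, let $\delta,\Omega,k_0\in\mathbb R$, let $\beta_{11},\beta_{12},\beta_{22}\ge 0$, and let $V_1,V_2\in L^\infty(\mathcal D,\mathbb R_{\ge0})$ satisfy $V_j-\tfrac12(|\delta|+|\Omega|+2k_0^2)\ge 0$ a.e. in $\mathcal D$. Regard $\mathbf H^1_0:=H^1_0(\mathcal D,\mathbb C^2)$ as a real Hilbert space with dual $\mathbf H^{-1}$, and put $(v,w):=\Re\int_{\mathcal D}(v_1\overline{w_1}+v_2\overline{w_2})\,dx$, $\|v\|^2:=(v,v)$, $\mathcal I v:=(v,\cdot)\in\mathbf H^{-1}$ and $\mathbb S:=\{v\in\mathbf H^1_0:\|v\|=1\}$. On $\mathbf H_0^1$ consider the energy $$E(u)=\tfrac12\,\Re\int_{\mathcal D}\Big[\tfrac12\big(|\nabla u_1|^2+|\nabla u_2|^2\big)+V_1|u_1|^2+V_2|u_2|^2+\tfrac\delta2\big(|u_1|^2-|u_2|^2\big)+\Omega\,\Re(u_1\overline{u_2})+ik_0\big(\overline{u_1}\partial_{x_1}u_1-\overline{u_2}\partial_{x_1}u_2\big)+\tfrac{\beta_{11}}2|u_1|^4+\tfrac{\beta_{22}}2|u_2|^4+\beta_{12}|u_1|^2|u_2|^2\Big]dx.$$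 For $u\neq0$ let $\mathcal A(u):\mathbf H^1_0\to\mathbf H^{-1}$ be given by $$\langle\mathcal A(u)v,w\rangle=\Re\int_{\mathcal D}\Big[\sum_{j=1}^2\big(\tfrac12\nabla v_j\cdot\nabla\overline{w_j}+V_jv_j\overline{w_j}\big)+\tfrac\delta2(v_1\overline{w_1}-v_2\overline{w_2})+\tfrac\Omega2(v_1\overline{w_2}+v_2\overline{w_1})+ik_0(\overline{w_1}\partial_{x_1}v_1-\overline{w_2}\partial_{x_1}v_2)\Big]dx$$ $$\qquad+\frac1{\|u\|^2}\,\Re\int_{\mathcal D}\Big[\sum_{j=1}^2\beta_{jj}|u_j|^2v_j\overline{w_j}+\beta_{12}\big(|u_2|^2v_1\overline{w_1}+|u_1|^2v_2\overline{w_2}\big)\Big]dx,$$ and let $\mathcal J(u):\mathbf H^1_0\to\mathbf H^{-1}$ be the real Fréchet derivative at $u$ of the map $z\mapsto\mathcal A(z)z$. Let $u\in\mathbb S$ be a local minimizer of $E$ on $\mathbb S$, and let $\lambda\in\mathbb R$ be its eigenvalue, i.e. $\langle E'(u),v\rangle=\lambda(u,v)$ for all $v\in\mathbf H^1_0$. Assume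 that $u$ is quasi-isolated, i.e. $$\langle E''(u)v,v\rangle-\lambda(v,v)>0\qquad\text{for all }v\in\mathbf H^1_0\setminus\{0\}\text{ with }(u,v)=(iu,v)=0.$$ Then $\ker(\mathcal J(u)-\lambda\mathcal I)=\operatorname{span}_{\mathbb R}\{u,iu\}$, and this space has real dimension $2$, i.e. the geometric multiplicity of $\lambda$ is $2$. Moreover there are no Jordan chains at $\lambda$: there is no $y\in\ker(\mathcal J(u)-\lambda\mathcal I)\setminus\{0\}$ for which $(\mathcal J(u)-\lambda\mathcal I)z=\mathcal I y$ has a solution $z\in\mathbf H^1_0$. Hence the algebraic multiplicity of $\lambda$, i.e. the real dimension of the space of all generalized eigenvectors (all $z_0$ for which there are $k\ge1$ and $z_1,\dots,z_k\in\mathbf H^1_0$ with $z_k=0$ and $(\mathcal J(u)-\lambda\mathcal I)z_{m}=\mathcal I z_{m+1}$ for $0\le m<k$), is also $2$. -/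

import Mathlib

open MeasureTheory Filter Topology
open scoped ENNReal NNReal ContDiff ComplexConjugate

namespace SOBEC

/-- The physical space `ℝ^d` with its Euclidean norm. -/
abbrev Space (d : ℕ) : Type := EuclideanSpace ℝ (Fin d)

/-- A Lipschitz domain: a nonempty connected open set which near each of its boundary points is,
in a suitable direction `e`, the strict epigraph of a Lipschitz function `g` of the variables
orthogonal to `e` (`g` is extended constantly along `e`). -/
def IsLipschitzDomain {d : ℕ} (D : Set (Space d)) : Prop :=
  IsOpen D ∧ IsConnected D ∧
    ∀ x ∈ frontier D, ∃ (e : Space d) (g : Space d → ℝ) (K : ℝ≥0) (r : ℝ),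
      ‖e‖ = 1 ∧ 0 < r ∧ LipschitzWith K g ∧ (∀ (y : Space d) (t : ℝ), g (y + t • e) = g y) ∧
      ∀ y ∈ Metric.ball x r, (y ∈ D ↔ g y < inner ℝ e y)

/-- The space `L²(D, ℂ)`. -/
abbrev L2 {d : ℕ} (D : Set (Space d)) : Type := Lp ℂ 2 (volume.restrict D)

/-- The pair `p = (φ, ∇φ)` comes from a test function `φ ∈ C_c^∞(D, ℂ)`. -/
def IsTestPair {d : ℕ} (D : Set (Space d)) (p : L2 D × (Fin d → L2 D)) : Prop :=
  ∃ φ : Space d → ℂ, ContDiff ℝ ∞ φ ∧ HasCompactSupport φ ∧ tsupport φ ⊆ D ∧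
    (p.1 : Space d → ℂ) =ᵐ[volume.restrict D] φ ∧
    ∀ i, (p.2 i : Space d → ℂ) =ᵐ[volume.restrict D]
      fun x => fderiv ℝ φ x (EuclideanSpace.single i 1)

/-- The subspace of all pairs `(φ, ∇φ)` with `φ ∈ C_c^∞(D, ℂ)`. -/
noncomputable def testPairs {d : ℕ} (D : Set (Space d)) : Submodule ℂ (L2 D × (Fin d → L2 D)) where
  carrier := {p | IsTestPair D p}
  zero_mem' := by
    refine ⟨0, contDiff_const, HasCompactSupport.zero, by simp, Lp.coeFn_zero _ _ _, fun i => ?_⟩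
    filter_upwards [Lp.coeFn_zero ℂ 2 (volume.restrict D)] with x hx
    simpa using hx
  add_mem' := by
    rintro p q ⟨φ, hφ, hcφ, hsφ, hp, hp'⟩ ⟨ψ, hψ, hcψ, hsψ, hq, hq'⟩
    refine ⟨φ + ψ, hφ.add hψ, hcφ.add hcψ,
      (tsupport_add φ ψ).trans (Set.union_subset hsφ hsψ), ?_, fun i => ?_⟩
    · filter_upwards [Lp.coeFn_add p.1 q.1, hp, hq] with x hx h1 h2
      simpa [h1, h2] using hx
    · filter_upwards [Lp.coeFn_add (p.2 i) (q.2 i), hp' i, hq' i] with x hx h1 h2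
      rw [fderiv_add (hφ.differentiable (by simp) x) (hψ.differentiable (by simp) x)]
      simpa [h1, h2] using hx
  smul_mem' := by
    rintro c p ⟨φ, hφ, hcφ, hsφ, hp, hp'⟩
    refine ⟨c • φ, hφ.const_smul c, hcφ.smul_left (f := fun _ => c),
      (closure_mono (Function.support_const_smul_subset c φ)).trans hsφ, ?_, fun i => ?_⟩
    · filter_upwards [Lp.coeFn_smul c p.1, hp] with x hx h1
      simpa [h1] using hx
    · filter_upwards [Lp.coeFn_smul c (p.2 i), hp' i] with x hx h1
      rw [fderiv_const_smul (hφ.differentiable (by simp) x)]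
      simpa [h1] using hx

/-- The Sobolev space `H¹₀(D, ℂ)`: the closure of `C_c^∞(D, ℂ)` in the `H¹` norm. A function `u` in
it is represented by the pair `(u, ∇u)` in `L² × (L²)^d` of the function and its weak gradient (a
limit of test pairs satisfies the weak derivative identity, so `u` determines `∇u`). The norm is
the maximum of the `L²` norms of `u` and the `∂ᵢu`, which is equivalent to the usual `H¹` norm. -/
noncomputable def H10 {d : ℕ} (D : Set (Space d)) : Submodule ℂ (L2 D × (Fin d → L2 D)) :=
  (testPairs D).topologicalClosure

/-- The space `H¹₀(D, ℂ²)` of two-component functions, as a normed space over `ℝ` (all derivatives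
below are real Fréchet derivatives); it also carries multiplication by complex scalars. -/
abbrev H {d : ℕ} (D : Set (Space d)) : Type := Fin 2 → H10 D


/-- The `L^p` norm over a set that contains the support. -/
theorem eLpNorm_restrict_of_support {α F : Type*} [MeasurableSpace α] [NormedAddCommGroup F]
    {μ : Measure α} {s : Set α} {f : α → F} {p : ℝ≥0∞} (h : Function.support f ⊆ s) :
    eLpNorm f p (μ.restrict s) = eLpNorm f p μ :=
  eLpNorm_restrict_eq_of_support_subset h

/-- The Sobolev inequality for `H¹₀` into `L⁴`, on test functions. -/
theorem sobolev_test {d : ℕ} (hd : d = 2 ∨ d = 3) {D : Set (Space d)}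
    (hb : Bornology.IsBounded D) : ∃ C : ℝ≥0, ∀ p : L2 D × (Fin d → L2 D), IsTestPair D p →
      eLpNorm p.1 4 (volume.restrict D) ≤ C * ‖p‖ₑ := by
  set μ := volume.restrict D with hμ
  have hfin : IsFiniteMeasure μ := ⟨by simpa [μ] using hb.measure_lt_top⟩
  set K : ℝ≥0 := eLpNormLESNormFDerivOfLeConst ℂ (volume : Measure (Space d)) D (12/7) 4
  set M : ℝ≥0∞ := μ Set.univ ^ (1 / (12/7 : ℝ≥0∞).toReal - 1 / (2 : ℝ≥0∞).toReal) with hM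
  have hMtop : M ≠ ⊤ := by
    refine ENNReal.rpow_ne_top_of_nonneg ?_ (measure_ne_top _ _)
    norm_num
  refine ⟨K * (d * M.toNNReal), fun p ⟨φ, hφ, hcφ, hsφ, hp, hp'⟩ => ?_⟩
  have h12 : ((12/7 : ℝ≥0) : ℝ≥0∞) = 12/7 := by
    rw [ENNReal.coe_div (by norm_num)]; norm_num
  have hdr : (d : ℝ≥0) = 2 ∨ (d : ℝ≥0) = 3 := by rcases hd with h | h <;> simp [h]
  have h1 : eLpNorm φ 4 volume ≤ K * eLpNorm (fderiv ℝ φ) (12/7 : ℝ≥0) volume := by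
    have := eLpNorm_le_eLpNorm_fderiv_of_le (F := ℂ) (μ := (volume : Measure (Space d)))
      (u := φ) (s := D) (p := 12/7) (q := 4) (hφ.of_le (by simp))
      ((subset_tsupport φ).trans hsφ) ?_ ?_ ?_ hb
    · simpa using this
    · rw [le_div_iff₀ (by norm_num)]; norm_num
    · rw [finrank_euclideanSpace_fin]
      rcases hdr with h | h <;> rw [h, div_lt_iff₀ (by norm_num)] <;> norm_num
    · rw [finrank_euclideanSpace_fin]
      rcases hd with h | h <;> rw [h] <;> norm_num
  have h2 : eLpNorm (fderiv ℝ φ) (12/7 : ℝ≥0) volume = eLpNorm (fderiv ℝ φ) (12/7 : ℝ≥0) μ := by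
    exact (eLpNorm_restrict_of_support ((support_fderiv_subset ℝ).trans hsφ)).symm
  have h3 : eLpNorm (fderiv ℝ φ) (12/7 : ℝ≥0) μ ≤ eLpNorm (fderiv ℝ φ) 2 μ * M := by
    rw [h12]
    refine eLpNorm_le_eLpNorm_mul_rpow_measure_univ ?_
      (hφ.continuous_fderiv (by simp)).aestronglyMeasurable
    rw [← h12, ← ENNReal.coe_ofNat, ENNReal.coe_le_coe, div_le_iff₀ (by norm_num)]; norm_num
  have h4 : eLpNorm (fderiv ℝ φ) 2 μ ≤ ∑ i, ‖p.2 i‖ₑ := by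
    have : eLpNorm (fderiv ℝ φ) 2 μ ≤
        eLpNorm (∑ i : Fin d, fun x => ‖p.2 i x‖) 2 μ := by
      refine eLpNorm_mono_ae_real ?_
      filter_upwards [ae_all_iff.2 hp'] with x hx
      refine ContinuousLinearMap.opNorm_le_bound _ (by simp; positivity) fun y => ?_
      have hy : y = ∑ i, y i • EuclideanSpace.single i (1:ℝ) := by
        ext j; simp [Finset.sum_apply, Pi.single_apply]
      conv_lhs => rw [hy]
      rw [map_sum, Finset.sum_apply, Finset.sum_mul]
      refine (norm_sum_le _ _).trans (Finset.sum_le_sum fun i _ => ?_)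
      rw [map_smul, norm_smul, ← hx i, mul_comm]
      gcongr
      exact PiLp.norm_apply_le y i
    refine this.trans ((eLpNorm_sum_le (fun i _ => (Lp.aestronglyMeasurable _).norm)
      (by norm_num)).trans (Finset.sum_le_sum fun i _ => ?_))
    rw [eLpNorm_norm, Lp.enorm_def]
  have h5 : ∑ i, ‖p.2 i‖ₑ ≤ d * ‖p‖ₑ := by
    have : ∀ i ∈ Finset.univ, ‖p.2 i‖ₑ ≤ ‖p‖ₑ := fun i _ => by
      rw [← ofReal_norm, ← ofReal_norm]
      exact ENNReal.ofReal_le_ofReal ((norm_le_pi_norm p.2 i).trans (norm_snd_le p))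
    simpa using Finset.sum_le_card_nsmul _ _ _ this
  calc eLpNorm p.1 4 μ = eLpNorm φ 4 μ := eLpNorm_congr_ae hp
    _ ≤ eLpNorm φ 4 volume := eLpNorm_restrict_le _ _ _ _
    _ ≤ K * ((d * ‖p‖ₑ) * M) := h1.trans (by
        rw [h2]; gcongr; exact h3.trans (by gcongr; exact h4.trans h5))
    _ = _ := by
      simp only [ENNReal.coe_mul, ENNReal.coe_natCast, ENNReal.coe_toNNReal hMtop]; ring

/-- The Sobolev inequality for `H¹₀` into `L⁴`. -/
theorem sobolev {d : ℕ} (hd : d = 2 ∨ d = 3) {D : Set (Space d)}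
    (hb : Bornology.IsBounded D) : ∃ C : ℝ≥0, ∀ p : H10 D,
      eLpNorm (p.1.1 : Space d → ℂ) 4 (volume.restrict D) ≤ C * ‖p‖ₑ := by
  obtain ⟨C, hC⟩ := sobolev_test hd hb
  refine ⟨C, fun ⟨p, hp⟩ => ?_⟩
  obtain ⟨q, hq, hlim⟩ := mem_closure_iff_seq_limit.1 hp
  have h1 : Tendsto (fun n => (q n).1) atTop (𝓝 p.1) := (continuous_fst.tendsto p).comp hlim
  obtain ⟨ns, hns, hae⟩ := (tendstoInMeasure_of_tendsto_Lp h1).exists_seq_tendsto_ae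
  have h2 := Lp.eLpNorm_lim_le_liminf_eLpNorm (p := 4)
    (fun n => Lp.aestronglyMeasurable (q (ns n)).1) _ hae
  have h3 : Tendsto (fun n => (C : ℝ≥0∞) * ‖q (ns n)‖ₑ) atTop (𝓝 (C * ‖p‖ₑ)) :=
    ENNReal.Tendsto.const_mul ((continuous_enorm.tendsto p).comp
      (hlim.comp hns.tendsto_atTop)) (Or.inr ENNReal.coe_ne_top)
  refine h2.trans ((liminf_le_liminf (Eventually.of_forall fun n => hC _ (hq (ns n)))).trans ?_)
  rw [h3.liminf_eq]; rfl

/-- The real `L^p`-`L^q` pairing with a fixed function is a continuous functional. -/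
theorem exists_pairing {d : ℕ} {D : Set (Space d)} {p q : ℝ≥0∞} [Fact (1 ≤ p)] [Fact (1 ≤ q)]
    [ENNReal.HolderConjugate p q] {f : Space d → ℂ} (hf : MemLp f p (volume.restrict D)) :
    ∃ L : Lp ℂ q (volume.restrict D) →L[ℝ] ℝ, ∀ g : Lp ℂ q (volume.restrict D),
      Integrable (fun x => (f x * conj (g x)).re) (volume.restrict D) ∧
      L g = ∫ x in D, (f x * conj (g x)).re := by
  have key : ∀ a b : ℂ, innerSL ℝ a b = (a * conj b).re := fun a b => by
    simp [Complex.inner]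
    ring
  refine ⟨(innerSL ℝ : ℂ →L[ℝ] ℂ →L[ℝ] ℝ).lpPairing (volume.restrict D) p q (hf.toLp f),
    fun g => ⟨?_, ?_⟩⟩
  · exact ((Lp.memLp g).star.integrable_mul hf).re.congr
      (Eventually.of_forall fun x => by simp [mul_comm])
  · rw [ContinuousLinearMap.lpPairing_eq_integral]
    refine integral_congr_ae ?_
    filter_upwards [hf.coeFn_toLp] with x hx
    rw [key, hx]

theorem memLp_four {d : ℕ} (hd : d = 2 ∨ d = 3) {D : Set (Space d)}
    (hb : Bornology.IsBounded D) (p : H10 D) :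
    MemLp (p.1.1 : Space d → ℂ) 4 (volume.restrict D) := by
  obtain ⟨C, hC⟩ := sobolev hd hb
  exact ⟨Lp.aestronglyMeasurable _,
    (hC p).trans_lt (ENNReal.mul_lt_top ENNReal.coe_lt_top enorm_lt_top)⟩

instance : Fact ((1 : ℝ≥0∞) ≤ 4) := ⟨by norm_num⟩

theorem exists_embedding {d : ℕ} (hd : d = 2 ∨ d = 3) {D : Set (Space d)}
    (hb : Bornology.IsBounded D) :
    ∃ ι : H10 D →L[ℝ] Lp ℂ 4 (volume.restrict D),
      ∀ p, (ι p : Space d → ℂ) =ᵐ[volume.restrict D] (p.1.1 : Space d → ℂ) := by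
  obtain ⟨C, hC⟩ := sobolev hd hb
  let ι : H10 D →ₗ[ℝ] Lp ℂ 4 (volume.restrict D) :=
    { toFun := fun p => (memLp_four hd hb p).toLp _
      map_add' := fun p q => by
        rw [← MemLp.toLp_add]
        exact MemLp.toLp_congr _ _ (Lp.coeFn_add p.1.1 q.1.1)
      map_smul' := fun c p => by
        rw [RingHom.id_apply, ← MemLp.toLp_const_smul]
        exact MemLp.toLp_congr _ _ (Lp.coeFn_smul c p.1.1) }
  refine ⟨ι.mkContinuous C fun p => ?_, fun p => (memLp_four hd hb p).coeFn_toLp⟩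
  have h := hC p
  change ‖(memLp_four hd hb p).toLp _‖ ≤ _
  rw [Lp.norm_toLp]
  exact (ENNReal.toReal_mono (by finiteness) h).trans (by simp)

theorem exists_pairing_four {d : ℕ} (hd : d = 2 ∨ d = 3) {D : Set (Space d)}
    (hb : Bornology.IsBounded D) {a b c : Space d → ℂ} (ha : MemLp a 4 (volume.restrict D))
    (hb' : MemLp b 4 (volume.restrict D)) (hc : MemLp c 4 (volume.restrict D)) :
    ∃ L : H10 D →L[ℝ] ℝ, ∀ w : H10 D,
      Integrable (fun x => (a x * b x * c x * conj (w.1.1 x)).re) (volume.restrict D) ∧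
      L w = ∫ x in D, (a x * b x * c x * conj (w.1.1 x)).re := by
  have h43 : (4/3 : ℝ≥0∞) = ((4/3 : ℝ≥0) : ℝ≥0∞) := by
    rw [ENNReal.coe_div (by norm_num)]; norm_num
  have e4 : (4 : ℝ≥0∞) = ((4 : ℝ≥0) : ℝ≥0∞) := by norm_num
  have e2 : (2 : ℝ≥0∞) = ((2 : ℝ≥0) : ℝ≥0∞) := by norm_num
  have e1 : (1 : ℝ≥0∞) = ((1 : ℝ≥0) : ℝ≥0∞) := by norm_num
  have : Fact ((1 : ℝ≥0∞) ≤ 4/3) := ⟨by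
    rw [h43, e1, ENNReal.coe_le_coe, le_div_iff₀ (by norm_num)]; norm_num⟩
  have i1 : ENNReal.HolderTriple 4 4 2 := ⟨by
    rw [e4, e2, ← ENNReal.coe_inv (by norm_num), ← ENNReal.coe_inv (by norm_num),
      ← ENNReal.coe_add, ENNReal.coe_inj]
    ext; push_cast; norm_num⟩
  have i2 : ENNReal.HolderTriple 2 4 (4/3) := ⟨by
    rw [h43, e4, e2, ← ENNReal.coe_inv (by norm_num), ← ENNReal.coe_inv (by norm_num),
      ← ENNReal.coe_inv (by norm_num), ← ENNReal.coe_add, ENNReal.coe_inj]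
    ext; push_cast; norm_num⟩
  have i3 : ENNReal.HolderConjugate (4/3) 4 := ⟨by
    rw [h43, e4, e1, ← ENNReal.coe_inv (by norm_num), ← ENNReal.coe_inv (by norm_num),
      ← ENNReal.coe_inv (by norm_num), ← ENNReal.coe_add, ENNReal.coe_inj]
    ext; push_cast; norm_num⟩
  have h2 : MemLp (fun x => a x * b x) 2 (volume.restrict D) := hb'.mul ha
  have h3 : MemLp (fun x => a x * b x * c x) (4/3) (volume.restrict D) := hc.mul h2
  obtain ⟨ι, hι⟩ := exists_embedding hd hb
  obtain ⟨L, hL⟩ := exists_pairing (q := 4) h3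
  refine ⟨L ∘L ι, fun w => ?_⟩
  have hae : (fun x => (a x * b x * c x * conj (ι w x)).re) =ᵐ[volume.restrict D]
      fun x => (a x * b x * c x * conj (w.1.1 x)).re := by
    filter_upwards [hι w] with x hx
    rw [hx]
  exact ⟨(hL (ι w)).1.congr hae, (hL (ι w)).2.trans (integral_congr_ae hae)⟩

/-- The data of a spin-orbit coupled pseudo-spin-1/2 condensate; `V 0`, `V 1` are the potentials
`V₁`, `V₂`. -/
structure Model (d : ℕ) where
  D : Set (Space d)
  V : Fin 2 → Space d → ℝ
  δ : ℝ
  Ω : ℝ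
  k₀ : ℝ
  β₁₁ : ℝ
  β₁₂ : ℝ
  β₂₂ : ℝ

/-- The component `u_{j+1}` of `u`. -/
noncomputable def comp {d : ℕ} {D : Set (Space d)} (u : H D) (j : Fin 2) : Space d → ℂ :=
  (u j).1.1

/-- The weak partial derivative `∂_{i+1} u_{j+1}`. -/
noncomputable def pd {d : ℕ} {D : Set (Space d)} (i : Fin d) (u : H D) (j : Fin 2) :
    Space d → ℂ :=
  (u j).1.2 i

/-- The real inner product of `L²(D, ℂ²)`. -/
noncomputable def l2 {d : ℕ} {D : Set (Space d)} (v w : H D) : ℝ :=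
  ∫ x in D, (comp v 0 x * conj (comp w 0 x) + comp v 1 x * conj (comp w 1 x)).re

namespace Model

/-- The standing assumptions: `D` is a bounded Lipschitz domain in dimension 2 or 3, the potentials
are bounded, nonnegative and strong enough, the interaction parameters are nonnegative. -/
structure Assumptions {d : ℕ} (P : Model d) : Prop where
  dim : d = 2 ∨ d = 3
  lipschitz : IsLipschitzDomain P.D
  bounded : Bornology.IsBounded P.D
  potential_bdd : ∀ j, MemLp (P.V j) ∞ (volume.restrict P.D)
  potential_nonneg : ∀ j, ∀ᵐ x ∂volume.restrict P.D, 0 ≤ P.V j x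
  potential_strong : ∀ j, ∀ᵐ x ∂volume.restrict P.D,
    0 ≤ P.V j x - (|P.δ| + |P.Ω| + 2 * P.k₀ ^ 2) / 2
  β₁₁_nonneg : 0 ≤ P.β₁₁
  β₁₂_nonneg : 0 ≤ P.β₁₂
  β₂₂_nonneg : 0 ≤ P.β₂₂

/-- The energy `E`. The coordinate `x₁` has index `0`. The spin-orbit term has a real integral over
`D` for `u` in `H¹₀`, so its real part is taken under the integral. -/
noncomputable def energy {d : ℕ} [NeZero d] (P : Model d) (u : H P.D) : ℝ :=
  1 / 2 * ∫ x in P.D,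
    (1 / 2 * (∑ i, ‖pd i u 0 x‖ ^ 2 + ∑ i, ‖pd i u 1 x‖ ^ 2)
      + (P.V 0 x * ‖comp u 0 x‖ ^ 2 + P.V 1 x * ‖comp u 1 x‖ ^ 2)
      + P.δ / 2 * (‖comp u 0 x‖ ^ 2 - ‖comp u 1 x‖ ^ 2)
      + P.Ω * (comp u 0 x * conj (comp u 1 x)).re
      + (Complex.I * P.k₀ *
          (conj (comp u 0 x) * pd 0 u 0 x - conj (comp u 1 x) * pd 0 u 1 x)).re
      + (P.β₁₁ / 2 * ‖comp u 0 x‖ ^ 4 + P.β₂₂ / 2 * ‖comp u 1 x‖ ^ 4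
          + P.β₁₂ * ‖comp u 0 x‖ ^ 2 * ‖comp u 1 x‖ ^ 2))

/-- The normalization manifold `𝕊`. -/
def sphere {d : ℕ} (P : Model d) : Set (H P.D) :=
  {u | ∫ x in P.D, (‖comp u 0 x‖ ^ 2 + ‖comp u 1 x‖ ^ 2) = 1}

/-- The form `⟨A(u)v, w⟩` of the linearized operator. -/
noncomputable def formA {d : ℕ} [NeZero d] (P : Model d) (u v w : H P.D) : ℝ :=
  (∫ x in P.D,
    (∑ j, (1 / 2 * ∑ i, pd i v j x * conj (pd i w j x)
        + P.V j x * comp v j x * conj (comp w j x))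
      + P.δ / 2 * (comp v 0 x * conj (comp w 0 x) - comp v 1 x * conj (comp w 1 x))
      + P.Ω / 2 * (comp v 0 x * conj (comp w 1 x) + comp v 1 x * conj (comp w 0 x))).re)
  + (∫ x in P.D,
      (Complex.I * P.k₀ *
        (conj (comp w 0 x) * pd 0 v 0 x - conj (comp w 1 x) * pd 0 v 1 x)).re)
  + ∫ x in P.D,
      (P.β₁₁ / l2 u u * ‖comp u 0 x‖ ^ 2 * comp v 0 x * conj (comp w 0 x)
        + P.β₂₂ / l2 u u * ‖comp u 1 x‖ ^ 2 * comp v 1 x * conj (comp w 1 x)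
        + P.β₁₂ / l2 u u * (‖comp u 1 x‖ ^ 2 * comp v 0 x * conj (comp w 0 x)
            + ‖comp u 0 x‖ ^ 2 * comp v 1 x * conj (comp w 1 x))).re


end Model

/-- `Φ` is linear in `w`, integrable, and its integral is a continuous functional of `w`. -/
def IsPairing {d : ℕ} {D : Set (Space d)} (Φ : H D → Space d → ℝ) : Prop :=
  ∃ L : H D →L[ℝ] ℝ, ∀ w, Integrable (Φ w) (volume.restrict D) ∧ L w = ∫ x in D, Φ w x

theorem IsPairing.add {d : ℕ} {D : Set (Space d)} {Φ Ψ : H D → Space d → ℝ}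
    (h : IsPairing Φ) (h' : IsPairing Ψ) : IsPairing (fun w x => Φ w x + Ψ w x) := by
  obtain ⟨L, hL⟩ := h
  obtain ⟨M, hM⟩ := h'
  refine ⟨L + M, fun w => ⟨(hL w).1.add (hM w).1, ?_⟩⟩
  rw [add_apply, (hL w).2, (hM w).2, integral_add (hL w).1 (hM w).1]

theorem IsPairing.const_mul {d : ℕ} {D : Set (Space d)} {Φ : H D → Space d → ℝ}
    (h : IsPairing Φ) (c : ℝ) : IsPairing (fun w x => c * Φ w x) := by
  obtain ⟨L, hL⟩ := h
  refine ⟨c • L, fun w => ⟨(hL w).1.const_mul c, ?_⟩⟩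
  rw [smul_apply, (hL w).2, integral_const_mul, smul_eq_mul]

theorem IsPairing.sum {d : ℕ} {D : Set (Space d)} {κ : Type*} (s : Finset κ)
    {Φ : κ → H D → Space d → ℝ} (h : ∀ k, IsPairing (Φ k)) :
    IsPairing (fun w x => ∑ k ∈ s, Φ k w x) := by
  choose L hL using h
  refine ⟨∑ k ∈ s, L k, fun w => ⟨integrable_finsetSum _ fun k _ => (hL k w).1, ?_⟩⟩
  rw [integral_finsetSum _ fun k _ => (hL k w).1, sum_apply]
  exact Finset.sum_congr rfl fun k _ => (hL k w).2

theorem isPairing_comp {d : ℕ} {D : Set (Space d)} {f : Space d → ℂ}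
    (hf : MemLp f 2 (volume.restrict D)) (j : Fin 2) :
    IsPairing (fun (w : H D) x => (f x * conj (comp w j x)).re) := by
  obtain ⟨L, hL⟩ := exists_pairing (q := 2) hf
  exact ⟨L ∘L ContinuousLinearMap.fst ℝ _ _ ∘L ((H10 D).subtypeL.restrictScalars ℝ) ∘L
    ContinuousLinearMap.proj j, fun w => hL _⟩

theorem isPairing_pd {d : ℕ} {D : Set (Space d)} {f : Space d → ℂ}
    (hf : MemLp f 2 (volume.restrict D)) (i : Fin d) (j : Fin 2) :
    IsPairing (fun (w : H D) x => (f x * conj (pd i w j x)).re) := by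
  obtain ⟨L, hL⟩ := exists_pairing (q := 2) hf
  exact ⟨L ∘L ContinuousLinearMap.proj (φ := fun _ : Fin d => L2 D) i ∘L ContinuousLinearMap.snd ℝ _ _ ∘L
    ((H10 D).subtypeL.restrictScalars ℝ) ∘L ContinuousLinearMap.proj j, fun w => hL _⟩

theorem isPairing_cubic {d : ℕ} (hd : d = 2 ∨ d = 3) {D : Set (Space d)}
    (hb : Bornology.IsBounded D) (u v : H D) (k j : Fin 2) :
    IsPairing (fun (w : H D) x => (comp u k x * conj (comp u k x) * comp v j x *
      conj (comp w j x)).re) := by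
  obtain ⟨L, hL⟩ := exists_pairing_four hd hb (memLp_four hd hb (u k))
    (memLp_four hd hb (u k)).star (memLp_four hd hb (v j))
  exact ⟨L ∘L ContinuousLinearMap.proj j, fun w => hL _⟩

theorem isPairing_l2 {d : ℕ} {D : Set (Space d)} (v : H D) :
    IsPairing (fun (w : H D) x =>
      (comp v 0 x * conj (comp w 0 x) + comp v 1 x * conj (comp w 1 x)).re) := by
  simp only [Complex.add_re]
  exact (isPairing_comp (Lp.memLp _) 0).add (isPairing_comp (Lp.memLp _) 1)

theorem memLp_comp {d : ℕ} {D : Set (Space d)} (v : H D) (j : Fin 2) :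
    MemLp (comp v j) 2 (volume.restrict D) := Lp.memLp _

theorem memLp_pd {d : ℕ} {D : Set (Space d)} (i : Fin d) (v : H D) (j : Fin 2) :
    MemLp (pd i v j) 2 (volume.restrict D) := Lp.memLp _

/-- `⟨A(u)v, ·⟩` is a continuous functional on `H¹₀`. -/
theorem exists_formA {d : ℕ} [NeZero d] {P : Model d} (hP : P.Assumptions) (u v : H P.D) :
    ∃ L : H P.D →L[ℝ] ℝ, ∀ w, L w = P.formA u v w := by
  have hV : ∀ j, MemLp (fun x => (P.V j x : ℂ) * comp v j x) 2 (volume.restrict P.D) :=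
    fun j => (memLp_comp v j).mul (hP.potential_bdd j).ofReal
  have h1 : IsPairing (fun (w : H P.D) x =>
      (∑ j, (1 / 2 * ∑ i, pd i v j x * conj (pd i w j x)
        + P.V j x * comp v j x * conj (comp w j x))
      + P.δ / 2 * (comp v 0 x * conj (comp w 0 x) - comp v 1 x * conj (comp w 1 x))
      + P.Ω / 2 * (comp v 0 x * conj (comp w 1 x) + comp v 1 x * conj (comp w 0 x))).re) := by
    convert ((IsPairing.sum Finset.univ fun j : Fin 2 =>
      ((IsPairing.sum Finset.univ fun i : Fin d =>
        isPairing_pd (memLp_pd i v j) i j).const_mul (1 / 2)).add (isPairing_comp (hV j) j)).add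
      (((isPairing_comp (memLp_comp v 0) 0).add
        ((isPairing_comp (memLp_comp v 1) 1).const_mul (-1))).const_mul (P.δ / 2))).add
      (((isPairing_comp (memLp_comp v 0) 1).add
        (isPairing_comp (memLp_comp v 1) 0)).const_mul (P.Ω / 2)) using 3 with w x
    have e2 : ∀ z : ℂ, (1 / 2 * z).re = 1 / 2 * z.re := fun z => by simp
    have e3 : ∀ (r : ℝ) (z : ℂ), (r / 2 * z).re = r / 2 * z.re := fun r z => by
      rw [← Complex.re_ofReal_mul]; norm_num
    simp only [Complex.add_re, Complex.sub_re, Complex.re_sum, e2, e3]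
    ring
  have h2 : IsPairing (fun (w : H P.D) x => (Complex.I * P.k₀ *
        (conj (comp w 0 x) * pd 0 v 0 x - conj (comp w 1 x) * pd 0 v 1 x)).re) := by
    convert (isPairing_comp ((memLp_pd 0 v 0).const_mul (Complex.I * P.k₀)) 0).add
      ((isPairing_comp ((memLp_pd 0 v 1).const_mul (Complex.I * P.k₀)) 1).const_mul (-1))
      using 3 with w x
    rw [neg_one_mul, ← Complex.neg_re, ← Complex.add_re]
    congr 1
    ring
  have h3 : IsPairing (fun (w : H P.D) x =>
      (P.β₁₁ / l2 u u * ‖comp u 0 x‖ ^ 2 * comp v 0 x * conj (comp w 0 x)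
        + P.β₂₂ / l2 u u * ‖comp u 1 x‖ ^ 2 * comp v 1 x * conj (comp w 1 x)
        + P.β₁₂ / l2 u u * (‖comp u 1 x‖ ^ 2 * comp v 0 x * conj (comp w 0 x)
            + ‖comp u 0 x‖ ^ 2 * comp v 1 x * conj (comp w 1 x))).re) := by
    have c := isPairing_cubic hP.dim hP.bounded u v
    convert (((c 0 0).const_mul (P.β₁₁ / l2 u u)).add ((c 1 1).const_mul (P.β₂₂ / l2 u u))).add
      (((c 1 0).add (c 0 1)).const_mul (P.β₁₂ / l2 u u)) using 3 with w x
    simp only [← Complex.add_re, ← Complex.re_ofReal_mul]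
    congr 1
    simp only [Complex.mul_conj, Complex.normSq_eq_norm_sq]
    push_cast
    ring
  obtain ⟨L₁, h₁⟩ := h1
  obtain ⟨L₂, h₂⟩ := h2
  obtain ⟨L₃, h₃⟩ := h3
  refine ⟨L₁ + L₂ + L₃, fun w => ?_⟩
  rw [add_apply, add_apply, (h₁ w).2, (h₂ w).2, (h₃ w).2,
    Model.formA]

/-- The map `I : H¹₀ → H⁻¹`, `I v = (v, ·)` in `L²`, as an element of `H⁻¹` for each `v`. -/
noncomputable def functionalI {d : ℕ} {D : Set (Space d)} (v : H D) : StrongDual ℝ (H D) where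
  toFun := l2 v
  map_add' := by
    obtain ⟨L, hL⟩ := isPairing_l2 v
    intro a b
    simp only [l2, ← (hL _).2, map_add]
  map_smul' := by
    obtain ⟨L, hL⟩ := isPairing_l2 v
    intro c a
    simp only [l2, ← (hL _).2, map_smul, RingHom.id_apply]
  cont := by
    obtain ⟨L, hL⟩ := isPairing_l2 v
    exact L.continuous.congr fun w => (hL w).2

theorem l2_comm {d : ℕ} {D : Set (Space d)} (v w : H D) : l2 v w = l2 w v := by
  refine integral_congr_ae (Eventually.of_forall fun x => ?_)
  simp [Complex.add_re, Complex.mul_re]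
  ring

/-- The linear map `I : H¹₀ → H⁻¹`. -/
noncomputable def operatorI {d : ℕ} (D : Set (Space d)) : H D →ₗ[ℝ] StrongDual ℝ (H D) where
  toFun := functionalI
  map_add' := fun v v' => by
    ext w
    have h := (functionalI w).map_add v v'
    change l2 w (v + v') = l2 w v + l2 w v' at h
    change l2 (v + v') w = l2 v w + l2 v' w
    simpa only [l2_comm _ w] using h
  map_smul' := fun c v => by
    ext w
    have h := (functionalI w).map_smul c v
    change l2 w (c • v) = c • l2 w v at h
    change l2 (c • v) w = c • l2 v w
    simpa only [l2_comm _ w] using h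

/-- The tangent space at `u` of the normalization manifold. -/
def tangent {d : ℕ} {D : Set (Space d)} (u : H D) : Set (H D) :=
  {v | l2 u v = 0}

namespace Model

/-- `A(u)v` as an element of `H⁻¹`. -/
noncomputable def operatorA {d : ℕ} [NeZero d] {P : Model d} (hP : P.Assumptions) (u v : H P.D) :
    StrongDual ℝ (H P.D) where
  toFun := P.formA u v
  map_add' := by
    obtain ⟨L, hL⟩ := exists_formA hP u v
    intro a b
    simp only [← hL, map_add]
  map_smul' := by
    obtain ⟨L, hL⟩ := exists_formA hP u v
    intro c a
    simp only [← hL, map_smul, RingHom.id_apply]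
  cont := by
    obtain ⟨L, hL⟩ := exists_formA hP u v
    exact L.continuous.congr hL

/-- `J(u)`, the Fréchet derivative at `u` of the map `z ↦ A(z)z` from `H¹₀` to `H⁻¹`. -/
noncomputable def operatorJ {d : ℕ} [NeZero d] {P : Model d} (hP : P.Assumptions) (u : H P.D) :
    H P.D →L[ℝ] StrongDual ℝ (H P.D) :=
  fderiv ℝ (fun z => operatorA hP z z) u

/-- `(u, lam)` is an eigenpair of the Gross-Pitaevskii problem:
`u ∈ 𝕊` and `⟨E'(u), v⟩ = lam (u, v)` for all `v`. -/
def IsEigenpair {d : ℕ} [NeZero d] (P : Model d) (u : H P.D) (lam : ℝ) : Prop :=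
  u ∈ P.sphere ∧ ∀ v, fderiv ℝ P.energy u v = lam * l2 u v

/-- Quasi-isolation: `E''(u) - lam` is positive on the nonzero directions that are
`L²`-orthogonal to `u` and `iu`. -/
def IsQuasiIsolated {d : ℕ} [NeZero d] (P : Model d) (u : H P.D) (lam : ℝ) : Prop :=
  ∀ v ∈ tangent u ∩ tangent (Complex.I • u), v ≠ 0 →
    0 < fderiv ℝ (fderiv ℝ P.energy) u v v - lam * l2 v v

end Model

/-- The eigenspace `ker (G - lam I)` of a generalized eigenvalue problem `G v = lam I v`. -/
def eigenspace {X : Type*} [NormedAddCommGroup X] [NormedSpace ℝ X]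
    (G I : X →ₗ[ℝ] StrongDual ℝ X) (lam : ℝ) : Submodule ℝ X :=
  LinearMap.ker (G - lam • I)

/-- There is a Jordan chain at `lam`: an eigenvector `y ≠ 0` and some `z` with
`(G - lam I) z = I y`. -/
def HasJordanChain {X : Type*} [NormedAddCommGroup X] [NormedSpace ℝ X]
    (G I : X →ₗ[ℝ] StrongDual ℝ X) (lam : ℝ) : Prop :=
  ∃ y ∈ eigenspace G I lam, y ≠ 0 ∧ ∃ z, (G - lam • I) z = I y

/-- The generalized eigenvectors of rank at most `k`: those `z` that start a chain
`(G - lam I) z = I z₁`, `(G - lam I) z₁ = I z₂`, ..., ending in `0` after `k` steps. -/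
def genEigenspace {X : Type*} [NormedAddCommGroup X] [NormedSpace ℝ X]
    (G I : X →ₗ[ℝ] StrongDual ℝ X) (lam : ℝ) : ℕ → Submodule ℝ X
  | 0 => ⊥
  | k + 1 => ((genEigenspace G I lam k).map I).comap (G - lam • I)

/-- The space of all generalized eigenvectors (the subspaces `genEigenspace G I lam k` increase
with `k`). -/
def rootSpace {X : Type*} [NormedAddCommGroup X] [NormedSpace ℝ X]
    (G I : X →ₗ[ℝ] StrongDual ℝ X) (lam : ℝ) : Submodule ℝ X :=
  ⨆ k, genEigenspace G I lam k

/-- The dimension of the eigenspace. -/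
noncomputable def geometricMultiplicity {X : Type*} [NormedAddCommGroup X] [NormedSpace ℝ X]
    (G I : X →ₗ[ℝ] StrongDual ℝ X) (lam : ℝ) : ℕ :=
  Module.finrank ℝ (eigenspace G I lam)

/-- The dimension of the space of all generalized eigenvectors. -/
noncomputable def algebraicMultiplicity {X : Type*} [NormedAddCommGroup X] [NormedSpace ℝ X]
    (G I : X →ₗ[ℝ] StrongDual ℝ X) (lam : ℝ) : ℕ :=
  Module.finrank ℝ (rootSpace G I lam)

end SOBEC

/-! Write the energy as `E z = A(z,z)/2 + G(R(z,z), R(z,z))/4`. Here `A` is the symmetric quadratic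
part, `R(v,w)` collects the two densities `Re (v_j conj w_j)`, and `G` is the interaction form on
pairs of densities. Then `A(z)z = A z + G(R(z,z), R(z,·)) / ‖z‖²`. At `‖u‖ = 1` the factor `1/‖z‖²`
is all that separates `J(u)` from the Hessian: `J(u)v = E''(u)v - 2 (u,v) G(R(u,u), R(u,·))`, so the
two agree on the orthogonal complement of `u`.

Both `u` and `iu` are eigenvectors. For `u`, the cubic terms add up to one copy, which leaves the
Euler-Lagrange equation. For `iu`, phase invariance gives `(u,iu) = 0` and `R(u,iu) = 0`, and the
remainder is the Euler-Lagrange equation tested with `iw`.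

Now let `(J(u) - lam I) z = I y` with `y` in the span of `u`, `iu`. Subtracting from `z` its `L²`
projection onto the span gives `v` orthogonal to `u`, `iu` with the same image `I y`. Pairing with
`v` gives `⟨(J(u) - lam I) v, v⟩ = (y,v) = 0`, so quasi-isolation forces `v = 0` and `z` lies in the
span. This one fact yields the kernel (`y = 0`), excludes Jordan chains, and by induction bounds all
generalized eigenvectors. It needs neither symmetry of `J(u)` nor compactness.

The abstract argument is `multiplicity_two`, fed by `exists_derivatives` through
`multiplicity_two_of_multilinear`. The analytic input is `exists_multilinear_representation`: the
embedding of `H¹₀` into `L⁴` puts the densities in `L²`, and integration by parts makes the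
spin-orbit term symmetric. -/

namespace SOBEC

/-! ### Derivatives of quartic functionals and semisimplicity of the eigenvalue -/

section Abstract

variable {X Y : Type*} [NormedAddCommGroup X] [NormedSpace ℝ X]
  [NormedAddCommGroup Y] [NormedSpace ℝ Y]

/-- The derivative of `z ↦ A z z / 2 + G (R z z) (R z z) / 4` for symmetric `A`, `R` and `G`. -/
noncomputable def quarticGradient (A : X →L[ℝ] X →L[ℝ] ℝ) (R : X →L[ℝ] X →L[ℝ] Y)
    (G : Y →L[ℝ] Y →L[ℝ] ℝ) (z : X) : StrongDual ℝ X :=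
  A z + (G (R z z)).comp (R z)

theorem hasFDerivAt_quartic {A : X →L[ℝ] X →L[ℝ] ℝ} {R : X →L[ℝ] X →L[ℝ] Y}
    {G : Y →L[ℝ] Y →L[ℝ] ℝ} (hA : ∀ v w, A v w = A w v) (hR : ∀ v w, R v w = R w v)
    (hG : ∀ p q, G p q = G q p) (z : X) :
    HasFDerivAt (fun z => 1 / 2 * A z z + 1 / 4 * G (R z z) (R z z))
      (quarticGradient A R G z) z := by
  have hRz := R.hasFDerivAt_of_bilinear (hasFDerivAt_id z) (hasFDerivAt_id z)
  have h := ((A.hasFDerivAt_of_bilinear (hasFDerivAt_id z) (hasFDerivAt_id z)).const_mul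
    (1 / 2)).add ((G.hasFDerivAt_of_bilinear hRz hRz).const_mul (1 / 4))
  refine h.congr_fderiv ?_
  ext w
  -- Symmetry merges the two derivative terms of `A` and the four of `G`, which cancels the factors
  -- 1/2 and 1/4.
  simp [quarticGradient, hA w z, hR w z, hG _ (R z z)]
  ring

/-- Product rule for composition, itself a bilinear map of the functional `G (R z z)` and the
operator `R z`. The term is shared by the energy gradient and by `A(z)z`. -/
theorem hasFDerivAt_cubic (R : X →L[ℝ] X →L[ℝ] Y) (G : Y →L[ℝ] Y →L[ℝ] ℝ) (z : X) :
    ∃ T : X →L[ℝ] StrongDual ℝ X,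
      HasFDerivAt (fun z => (G (R z z)).comp (R z)) T z ∧
      ∀ v w, T v w = G (R v z + R z v) (R z w) + G (R z z) (R v w) := by
  have hRz := R.hasFDerivAt_of_bilinear (hasFDerivAt_id z) (hasFDerivAt_id z)
  refine ⟨_, (ContinuousLinearMap.compL ℝ X Y ℝ).hasFDerivAt_of_bilinear
    (G.hasFDerivAt.comp z hRz) R.hasFDerivAt, fun v w => ?_⟩
  simp
  ring

/-- The derivative at `u` of the normalized operator `z ↦ A z + G (R z z) (R z ·) / S z z`, and the
Hessian at `u` of the quartic energy. -/
theorem exists_derivatives {A : X →L[ℝ] X →L[ℝ] ℝ} {R : X →L[ℝ] X →L[ℝ] Y}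
    {G : Y →L[ℝ] Y →L[ℝ] ℝ} {S : X →L[ℝ] X →L[ℝ] ℝ} (hA : ∀ v w, A v w = A w v)
    (hR : ∀ v w, R v w = R w v) (hG : ∀ p q, G p q = G q p) (hS : ∀ v w, S v w = S w v)
    {u : X} (hu : S u u = 1) :
    (∀ v w, fderiv ℝ (fun z => A z + (S z z)⁻¹ • (G (R z z)).comp (R z)) u v w =
      A v w + (2 * G (R u v) (R u w) + G (R u u) (R v w)) - 2 * S u v * G (R u u) (R u w)) ∧
    ∀ v w, fderiv ℝ (fderiv ℝ fun z => 1 / 2 * A z z + 1 / 4 * G (R z z) (R z z)) u v w =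
      A v w + (2 * G (R u v) (R u w) + G (R u u) (R v w)) := by
  obtain ⟨T, hT, hT'⟩ := hasFDerivAt_cubic R G u
  have hSu := S.hasFDerivAt_of_bilinear (hasFDerivAt_id u) (hasFDerivAt_id u)
  constructor
  · intro v w
    -- As `S u u = 1`, the inverse has derivative `-2 S u v` at `u`; this produces the only term of
    -- `J(u)` that is absent from the Hessian.
    have h := A.hasFDerivAt.add ((HasDerivAt.comp_hasFDerivAt (f := fun z => S z z) u
      (hasDerivAt_inv (by simp [hu] : S u u ≠ 0)) hSu).smul hT)
    rw [show fderiv ℝ (fun z => A z + (S z z)⁻¹ • (G (R z z)).comp (R z)) u = _ from h.fderiv]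
    simp [hT', hu, hS v u, hR v u]
    ring
  · intro v w
    have h := A.hasFDerivAt.add hT
    -- The gradient has to be known at every `z`, not only at `u`, before it can be differentiated
    -- again.
    have e : (fderiv ℝ fun z => 1 / 2 * A z z + 1 / 4 * G (R z z) (R z z)) =
        fun z => A z + (G (R z z)).comp (R z) :=
      funext fun z => (hasFDerivAt_quartic hA hR hG z).fderiv
    rw [e, show fderiv ℝ (fun z => A z + (G (R z z)).comp (R z)) u = _ from h.fderiv]
    simp [hT', hR v u]
    ring

/-- If `G - lam I` kills the orthonormal vectors `u`, `w` and is definite on their orthogonal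
complement, then `lam` is semisimple with eigenspace spanned by `u` and `w`. -/
theorem multiplicity_two {G I : X →ₗ[ℝ] StrongDual ℝ X} {lam : ℝ} {u w : X}
    (hI : ∀ v v', I v v' = I v' v) (huu : I u u = 1) (hww : I w w = 1) (huw : I u w = 0)
    (hu : (G - lam • I) u = 0) (hw : (G - lam • I) w = 0)
    (hpos : ∀ v, I u v = 0 → I w v = 0 → v ≠ 0 → 0 < (G - lam • I) v v) :
    eigenspace G I lam = Submodule.span ℝ {u, w} ∧ geometricMultiplicity G I lam = 2 ∧
      ¬ HasJordanChain G I lam ∧ algebraicMultiplicity G I lam = 2 := by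
  have hwu : I w u = 0 := by rw [hI, huw]
  have hle : Submodule.span ℝ {u, w} ≤ eigenspace G I lam := by
    rw [Submodule.span_le]
    rintro _ (rfl | rfl)
    exacts [hu, hw]
  -- The heart of the argument: whatever is mapped into `I (span {u, w})` already lies in the span.
  have hchain : ∀ z, ∀ y ∈ Submodule.span ℝ {u, w}, (G - lam • I) z = I y →
      z ∈ Submodule.span ℝ {u, w} := by
    intro z y hy hz
    obtain ⟨a, b, rfl⟩ := Submodule.mem_span_pair.1 hy
    have hv : z - (I u z • u + I w z • w) = 0 := by
      by_contra h
      set v := z - (I u z • u + I w z • w) with hvdef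
      have h1 : I u v = 0 := by simp [hvdef, huu, huw]
      have h2 : I w v = 0 := by simp [hvdef, hww, hwu]
      -- The subtracted projection lies in the kernel, so `v` has the same image as `z`; that image
      -- vanishes on `v` by orthogonality, against `hpos`.
      have h3 : (G - lam • I) v = I (a • u + b • w) := by
        rw [hvdef, map_sub, map_add, map_smul, map_smul, hu, hw, hz]
        simp
      have := hpos v h1 h2 h
      rw [h3] at this
      simp [h1, h2] at this
    rw [sub_eq_zero.1 hv]
    exact Submodule.mem_span_pair.2 ⟨_, _, rfl⟩
  have heq : eigenspace G I lam = Submodule.span ℝ {u, w} :=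
    le_antisymm (fun z hz => hchain z 0 (zero_mem _) (by rw [map_zero]; exact hz)) hle
  have hli : LinearIndependent ℝ ![u, w] := by
    rw [LinearIndependent.pair_iff]
    intro a b hab
    have h1 := congrArg (I u) hab
    have h2 := congrArg (I w) hab
    simp [huu, huw] at h1
    simp [hww, hwu] at h2
    exact ⟨h1, h2⟩
  have hdim : Module.finrank ℝ (Submodule.span ℝ {u, w}) = 2 := by
    have := finrank_span_eq_card hli
    rwa [Matrix.range_cons_cons_empty, Fintype.card_fin] at this
  have hgen : ∀ k, genEigenspace G I lam k ≤ Submodule.span ℝ {u, w} := by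
    intro k
    induction k with
    | zero => exact bot_le
    | succ k ih =>
      rintro z ⟨y, hy, hz⟩
      exact hchain z y (ih hy) hz.symm
  have hroot : rootSpace G I lam = Submodule.span ℝ {u, w} := by
    -- Level 0 of the chain of generalized eigenspaces is `⊥`; the kernel is level 1.
    refine le_antisymm (iSup_le hgen) (le_trans ?_ (le_iSup _ 1))
    intro z hz
    exact ⟨0, zero_mem _, by rw [map_zero]; exact (hle hz).symm⟩
  refine ⟨heq, by rw [geometricMultiplicity, heq, hdim], ?_,
    by rw [algebraicMultiplicity, hroot, hdim]⟩
  rintro ⟨y, hy, hy0, z, hz⟩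
  rw [heq] at hy
  -- A chain would start at `z` in the span, hence in the kernel, so `I y = 0`. Testing with `u` and
  -- `w` gives `y = 0`; injectivity of `I` on the whole space is not needed.
  have h0 : (G - lam • I) z = 0 := hle (hchain z y hy hz)
  rw [h0] at hz
  obtain ⟨a, b, rfl⟩ := Submodule.mem_span_pair.1 hy
  have h1 := congrArg (fun f => f u) hz
  have h2 := congrArg (fun f => f w) hz
  simp [huu, hwu] at h1
  simp [hww, huw] at h2
  exact hy0 (by simp [← h1, ← h2])

end Abstract
-- Integration by parts, `L²` inner products and densities
section Forms

/-- Combinations of inner products of the images of two vectors are continuous bilinear forms. -/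
theorem exists_form {X Z : Type*} [NormedAddCommGroup X] [NormedSpace ℝ X]
    [NormedAddCommGroup Z] [InnerProductSpace ℝ Z] {κ : Type*} (s : Finset κ) (a : κ → ℝ)
    (T T' : κ → X →L[ℝ] Z) :
    ∃ B : X →L[ℝ] X →L[ℝ] ℝ, ∀ v w, B v w = ∑ k ∈ s, a k * inner ℝ (T k v) (T' k w) :=
  ⟨∑ k ∈ s, a k • (innerSL ℝ).bilinearComp (T k) (T' k), fun v w => by simp [sum_apply]⟩

variable {d : ℕ} {D : Set (Space d)}

/-- Integration by parts on test functions. -/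
theorem inner_partial_testPair {p q : L2 D × (Fin d → L2 D)} (hp : IsTestPair D p)
    (hq : IsTestPair D q) (i : Fin d) : inner ℝ (p.2 i) q.1 = -inner ℝ p.1 (q.2 i) := by
  obtain ⟨φ, hφ, hcφ, hsφ, h1, h2⟩ := hp
  obtain ⟨ψ, hψ, hcψ, hsψ, h3, h4⟩ := hq
  set e : Space d := EuclideanSpace.single i 1
  have cφ : Continuous fun x => fderiv ℝ φ x e :=
    (hφ.continuous_fderiv (by simp)).clm_apply continuous_const
  have cψ : Continuous fun x => fderiv ℝ ψ x e :=
    (hψ.continuous_fderiv (by simp)).clm_apply continuous_const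
  have hint : ∀ {f g : Space d → ℂ}, Continuous f → Continuous g → HasCompactSupport g →
      Integrable (fun x => (innerSL ℝ : ℂ →L[ℝ] ℂ →L[ℝ] ℝ) (f x) (g x)) volume :=
    fun {f g} hf hg hc => Continuous.integrable_of_hasCompactSupport
      (by simpa using (hf.inner hg : Continuous fun x => inner ℝ (f x) (g x)))
      (hc.mono fun x hx hgx => hx (by simp [hgx]))
  have hcψ' : HasCompactSupport fun x => fderiv ℝ ψ x e := hcψ.fderiv_apply ℝ e
  have key := integral_bilinear_fderiv_right_eq_neg_left_of_integrable (μ := volume)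
    (B := (innerSL ℝ : ℂ →L[ℝ] ℂ →L[ℝ] ℝ)) (f := φ) (g := ψ) (v := e)
    (hint cφ hψ.continuous hcψ) (hint hφ.continuous cψ hcψ') (hint hφ.continuous hψ.continuous hcψ)
    (fun x _ => hφ.differentiable (by simp) x) (fun x _ => hψ.differentiable (by simp) x)
  -- The integration by parts takes place on the whole space; the test functions vanish off `D`, so
  -- the integrals over `D` are the same and no boundary term occurs.
  have hset : ∀ f : Space d → ℂ, ∫ x in D, innerSL ℝ (f x) (ψ x) = ∫ x, innerSL ℝ (f x) (ψ x) :=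
    fun f => setIntegral_eq_integral_of_forall_compl_eq_zero fun x hx => by
      simp [image_eq_zero_of_notMem_tsupport fun h => hx (hsψ h)]
  have hset' : ∫ x in D, innerSL ℝ (φ x) (fderiv ℝ ψ x e) =
      ∫ x, innerSL ℝ (φ x) (fderiv ℝ ψ x e) :=
    setIntegral_eq_integral_of_forall_compl_eq_zero fun x hx => by
      simp [image_eq_zero_of_notMem_tsupport fun h => hx (hsφ h)]
  have e1 : inner ℝ (p.2 i) q.1 = ∫ x in D, innerSL ℝ (fderiv ℝ φ x e) (ψ x) := by
    rw [L2.inner_def]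
    refine integral_congr_ae ?_
    filter_upwards [h2 i, h3] with x hx hx'
    simp [hx, hx', e]
  have e2 : inner ℝ p.1 (q.2 i) = ∫ x in D, innerSL ℝ (φ x) (fderiv ℝ ψ x e) := by
    rw [L2.inner_def]
    refine integral_congr_ae ?_
    filter_upwards [h1, h4 i] with x hx hx'
    simp [hx, hx', e]
  rw [e1, e2, hset, hset', key, neg_neg]

/-- Integration by parts in `H¹₀`. -/
theorem inner_partial {p q : L2 D × (Fin d → L2 D)} (hp : p ∈ H10 D) (hq : q ∈ H10 D)
    (i : Fin d) : inner ℝ (p.2 i) q.1 = -inner ℝ p.1 (q.2 i) := by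
  -- Both sides are continuous in each argument separately, so the identity passes to the closure
  -- first in `p`, for a fixed test pair `q`, and then in `q`.
  have h1 : ∀ q, IsTestPair D q → ∀ p ∈ H10 D, inner ℝ (p.2 i) q.1 = -inner ℝ p.1 (q.2 i) :=
    fun q hq p hp => closure_minimal (s := {p | IsTestPair D p})
      (t := {p | inner ℝ (p.2 i) q.1 = -inner ℝ p.1 (q.2 i)})
      (fun p hp => inner_partial_testPair hp hq i)
      (isClosed_eq (by fun_prop) (by fun_prop)) hp
  exact closure_minimal (s := {q | IsTestPair D q})
      (t := {q | inner ℝ (p.2 i) q.1 = -inner ℝ p.1 (q.2 i)})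
      (fun q hq => h1 q hq p hp) (isClosed_eq (by fun_prop) (by fun_prop)) hq

/-- Multiplication by `i` is a pointwise isometry. The phase invariance of the quadratic energy
rests on this. -/
theorem inner_I_smul (f g : L2 D) :
    inner ℝ (Complex.I • f) (Complex.I • g) = inner ℝ f g := by
  rw [L2.inner_def, L2.inner_def]
  refine integral_congr_ae ?_
  filter_upwards [Lp.coeFn_smul Complex.I f, Lp.coeFn_smul Complex.I g] with x h1 h2
  simp only [h1, h2, Pi.smul_apply, smul_eq_mul, Complex.inner]
  simp

/-- `f` is integrable with integral `c`. -/
def HasIntegralEq {α : Type*} [MeasurableSpace α] (μ : Measure α) (f : α → ℝ) (c : ℝ) : Prop :=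
  Integrable f μ ∧ ∫ x, f x ∂μ = c

namespace HasIntegralEq

variable {α : Type*} [MeasurableSpace α] {μ : Measure α} {f g : α → ℝ} {a b : ℝ}

theorem add (hf : HasIntegralEq μ f a) (hg : HasIntegralEq μ g b) :
    HasIntegralEq μ (fun x => f x + g x) (a + b) :=
  ⟨hf.1.add hg.1, by rw [integral_add hf.1 hg.1, hf.2, hg.2]⟩

theorem sub (hf : HasIntegralEq μ f a) (hg : HasIntegralEq μ g b) :
    HasIntegralEq μ (fun x => f x - g x) (a - b) :=
  ⟨hf.1.sub hg.1, by rw [integral_sub hf.1 hg.1, hf.2, hg.2]⟩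

theorem const_mul (hf : HasIntegralEq μ f a) (c : ℝ) :
    HasIntegralEq μ (fun x => c * f x) (c * a) :=
  ⟨hf.1.const_mul c, by rw [integral_const_mul, hf.2]⟩

theorem sum {κ : Type*} (s : Finset κ) {f : κ → α → ℝ} {a : κ → ℝ}
    (h : ∀ k, HasIntegralEq μ (f k) (a k)) :
    HasIntegralEq μ (fun x => ∑ k ∈ s, f k x) (∑ k ∈ s, a k) :=
  ⟨integrable_finsetSum _ fun k _ => (h k).1, by
    rw [integral_finsetSum _ fun k _ => (h k).1]
    exact Finset.sum_congr rfl fun k _ => (h k).2⟩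

theorem congr (hf : HasIntegralEq μ f a) (h : f =ᵐ[μ] g) : HasIntegralEq μ g a :=
  ⟨hf.1.congr h, by rw [← integral_congr_ae h, hf.2]⟩

end HasIntegralEq

/-- The dictionary between the integrals that define the model and inner products in `L²`.
Integrability is carried along so that sums of integrals can be merged. -/
theorem hasIntegralEq_inner (f g : L2 D) :
    HasIntegralEq (volume.restrict D) (fun x => (f x * conj (g x)).re) (inner ℝ f g) := by
  have e : ∀ a b : ℂ, inner ℝ a b = (a * conj b).re := fun a b => by
    simp [Complex.inner]
    ring
  refine ⟨(L2.integrable_inner (𝕜 := ℝ) f g).congr (Eventually.of_forall fun x => e _ _), ?_⟩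
  rw [L2.inner_def]
  exact integral_congr_ae (Eventually.of_forall fun x => (e _ _).symm)

/-- Multiplication by a bounded real function on `L²`. -/
theorem exists_multiplication {V : Space d → ℝ} (hV : MemLp V ∞ (volume.restrict D)) :
    ∃ M : L2 D →L[ℝ] L2 D, ∀ f, M f =ᵐ[volume.restrict D] fun x => (V x : ℂ) * f x := by
  refine ⟨(ContinuousLinearMap.lsmul ℝ ℝ : ℝ →L[ℝ] ℂ →L[ℝ] ℂ).holderL (volume.restrict D) ∞ 2 2
    (hV.toLp V), fun f => ?_⟩
  filter_upwards [(ContinuousLinearMap.lsmul ℝ ℝ : ℝ →L[ℝ] ℂ →L[ℝ] ℂ).coeFn_holder (r := 2)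
    (hV.toLp V) f, hV.coeFn_toLp] with x h1 h2
  refine h1.trans ?_
  simp [h2]

/-- The function `Re (v_j conj w_j)` in `L²` depends continuously on `v`, `w`. -/
theorem exists_density (hd : d = 2 ∨ d = 3) (hb : Bornology.IsBounded D) (j : Fin 2) :
    ∃ ρ : H D →L[ℝ] H D →L[ℝ] Lp ℝ 2 (volume.restrict D), ∀ v w,
      ρ v w =ᵐ[volume.restrict D] fun x => (comp v j x * conj (comp w j x)).re := by
  have e4 : (4 : ℝ≥0∞) = ((4 : ℝ≥0) : ℝ≥0∞) := by norm_num
  have e2 : (2 : ℝ≥0∞) = ((2 : ℝ≥0) : ℝ≥0∞) := by norm_num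
  have i1 : ENNReal.HolderTriple 4 4 2 := ⟨by
    rw [e4, e2, ← ENNReal.coe_inv (by norm_num), ← ENNReal.coe_inv (by norm_num),
      ← ENNReal.coe_add, ENNReal.coe_inj]
    ext; push_cast; norm_num⟩
  obtain ⟨ι, hι⟩ := exists_embedding hd hb
  -- Continuity comes from the Sobolev embedding into `L⁴` followed by Hölder with 1/4 + 1/4 = 1/2.
  let T : H D →L[ℝ] Lp ℂ 4 (volume.restrict D) := ι ∘L ContinuousLinearMap.proj j
  refine ⟨((innerSL ℝ : ℂ →L[ℝ] ℂ →L[ℝ] ℝ).holderL (volume.restrict D) 4 4 2).bilinearComp T T,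
    fun v w => ?_⟩
  filter_upwards [(innerSL ℝ : ℂ →L[ℝ] ℂ →L[ℝ] ℝ).coeFn_holder (r := 2) (T v) (T w), hι (v j),
    hι (w j)] with x h1 h2 h3
  refine h1.trans ?_
  change innerSL ℝ (ι (v j) x) (ι (w j) x) = _
  rw [h2, h3]
  simp [Complex.inner, comp]
  ring

theorem comp_I_smul (v : H D) (j : Fin 2) :
    comp (Complex.I • v) j =ᵐ[volume.restrict D] fun x => Complex.I * comp v j x :=
  Lp.coeFn_smul Complex.I (v j).1.1

/-- The `j`-th component as an element of `L²`. -/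
noncomputable def componentL (D : Set (Space d)) (j : Fin 2) : H D →L[ℝ] L2 D :=
  ContinuousLinearMap.fst ℝ _ _ ∘L ((H10 D).subtypeL.restrictScalars ℝ) ∘L
    ContinuousLinearMap.proj j

/-- The `i`-th weak derivative of the `j`-th component as an element of `L²`. -/
noncomputable def partialL (D : Set (Space d)) (i : Fin d) (j : Fin 2) : H D →L[ℝ] L2 D :=
  ContinuousLinearMap.proj (φ := fun _ : Fin d => L2 D) i ∘L ContinuousLinearMap.snd ℝ _ _ ∘L
    ((H10 D).subtypeL.restrictScalars ℝ) ∘L ContinuousLinearMap.proj j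

theorem componentL_I_smul (j : Fin 2) (v : H D) :
    componentL D j (Complex.I • v) = Complex.I • componentL D j v := rfl

theorem partialL_I_smul (i : Fin d) (j : Fin 2) (v : H D) :
    partialL D i j (Complex.I • v) = Complex.I • partialL D i j v := rfl

theorem inner_partialL (i : Fin d) (j : Fin 2) (v w : H D) :
    inner ℝ (partialL D i j v) (componentL D j w) =
      -inner ℝ (componentL D j v) (partialL D i j w) :=
  inner_partial (v j).2 (w j).2 i

theorem l2_eq_inner (v w : H D) : l2 v w =
    inner ℝ (componentL D 0 v) (componentL D 0 w) +
      inner ℝ (componentL D 1 v) (componentL D 1 w) := by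
  simp only [l2, Complex.add_re]
  exact ((hasIntegralEq_inner (componentL D 0 v) (componentL D 0 w)).add
    (hasIntegralEq_inner (componentL D 1 v) (componentL D 1 w))).2

theorem l2_I_smul (v w : H D) : l2 (Complex.I • v) (Complex.I • w) = l2 v w := by
  simp only [l2_eq_inner, componentL_I_smul, inner_I_smul]

/-- The `L²` inner product as a continuous form on `H¹₀`. -/
theorem exists_l2_form (D : Set (Space d)) : ∃ S : H D →L[ℝ] H D →L[ℝ] ℝ, ∀ v w,
    S v w = l2 v w := by
  obtain ⟨S, hS⟩ := exists_form Finset.univ (fun _ => 1) (componentL D) (componentL D)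
  exact ⟨S, fun v w => by simp [hS, l2_eq_inner, Fin.sum_univ_two]⟩

end Forms
-- The linear part of the operator: symmetry and phase invariance
section LinearPart

/-- The linear part of the operator in terms of component maps `c`, derivatives `p`, multiplication
operators `M` and a complex structure `K`. -/
theorem exists_linearPart {X Z : Type*} [NormedAddCommGroup X] [NormedSpace ℝ X]
    [NormedAddCommGroup Z] [InnerProductSpace ℝ Z] {d : ℕ} [NeZero d] (c : Fin 2 → X →L[ℝ] Z)
    (p : Fin d → Fin 2 → X →L[ℝ] Z) (M : Fin 2 → Z →L[ℝ] Z) (K : Z →L[ℝ] Z) (δ Ω k : ℝ) :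
    ∃ A : X →L[ℝ] X →L[ℝ] ℝ, ∀ v w, A v w =
      ((∑ j, (1 / 2 * ∑ i, inner ℝ (p i j v) (p i j w) + inner ℝ (M j (c j v)) (c j w))
        + δ / 2 * (inner ℝ (c 0 v) (c 0 w) - inner ℝ (c 1 v) (c 1 w)))
        + Ω / 2 * (inner ℝ (c 0 v) (c 1 w) + inner ℝ (c 1 v) (c 0 w)))
      + k * (inner ℝ (K (p 0 0 v)) (c 0 w) - inner ℝ (K (p 0 1 v)) (c 1 w)) := by
  let B (T T' : X →L[ℝ] Z) : X →L[ℝ] X →L[ℝ] ℝ := (innerSL ℝ).bilinearComp T T'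
  have hB : ∀ T T' v w, B T T' v w = inner ℝ (T v) (T' w) := fun _ _ _ _ => rfl
  refine ⟨((∑ j, ((1 / 2 : ℝ) • ∑ i, B (p i j) (p i j) + B (M j ∘L c j) (c j))
    + (δ / 2) • (B (c 0) (c 0) - B (c 1) (c 1))) + (Ω / 2) • (B (c 0) (c 1) + B (c 1) (c 0)))
    + k • (B (K ∘L p 0 0) (c 0) - B (K ∘L p 0 1) (c 1)), fun v w => ?_⟩
  simp [hB, sum_apply]
  ring

variable {d : ℕ}

/-- Multiplication by `i` on `L²`. -/
noncomputable def mulI (D : Set (Space d)) : L2 D →L[ℝ] L2 D :=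
  (Complex.I • ContinuousLinearMap.id ℂ (L2 D)).restrictScalars ℝ

theorem mulI_apply {D : Set (Space d)} (f : L2 D) : mulI D f = Complex.I • f := rfl

theorem I_smul_I_smul {D : Set (Space d)} (f : L2 D) : Complex.I • Complex.I • f = -f := by
  rw [smul_smul, Complex.I_mul_I, neg_one_smul]

/-- The spin-orbit term is symmetric. -/
theorem inner_mulI_partialL {D : Set (Space d)} (i : Fin d) (j : Fin 2) (v w : H D) :
    inner ℝ (mulI D (partialL D i j v)) (componentL D j w) =
      inner ℝ (mulI D (partialL D i j w)) (componentL D j v) := by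
  -- `(i∂v, w) = (∂(iv), w) = -(iv, ∂w) = -(iiv, i∂w) = (v, i∂w)`: the sign from integration by
  -- parts cancels against `i² = -1`.
  rw [mulI_apply, ← partialL_I_smul, inner_partialL, componentL_I_smul,
    ← inner_I_smul, I_smul_I_smul, inner_neg_left, neg_neg, real_inner_comm, mulI_apply]

variable [NeZero d] {P : Model d}

/-- The part of the operator `A(u)` without interaction: a symmetric continuous form that is
invariant under multiplication by `i`, whose diagonal is the quadratic part of the energy. -/
theorem exists_operatorA_linear (hP : P.Assumptions) :
    ∃ A : H P.D →L[ℝ] H P.D →L[ℝ] ℝ, (∀ v w, A v w = A w v) ∧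
      (∀ v w, A (Complex.I • v) (Complex.I • w) = A v w) ∧
      (∀ v w, A v w = (∫ x in P.D,
        (∑ j, (1 / 2 * ∑ i, pd i v j x * conj (pd i w j x)
          + P.V j x * comp v j x * conj (comp w j x))
        + P.δ / 2 * (comp v 0 x * conj (comp w 0 x) - comp v 1 x * conj (comp w 1 x))
        + P.Ω / 2 * (comp v 0 x * conj (comp w 1 x) + comp v 1 x * conj (comp w 0 x))).re)
        + ∫ x in P.D, (Complex.I * P.k₀ *
          (conj (comp w 0 x) * pd 0 v 0 x - conj (comp w 1 x) * pd 0 v 1 x)).re) ∧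
      ∀ v, HasIntegralEq (volume.restrict P.D) (fun x =>
        1 / 2 * (∑ i, ‖pd i v 0 x‖ ^ 2 + ∑ i, ‖pd i v 1 x‖ ^ 2)
        + (P.V 0 x * ‖comp v 0 x‖ ^ 2 + P.V 1 x * ‖comp v 1 x‖ ^ 2)
        + P.δ / 2 * (‖comp v 0 x‖ ^ 2 - ‖comp v 1 x‖ ^ 2)
        + P.Ω * (comp v 0 x * conj (comp v 1 x)).re
        + (Complex.I * P.k₀ *
          (conj (comp v 0 x) * pd 0 v 0 x - conj (comp v 1 x) * pd 0 v 1 x)).re) (A v v) := by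
  choose M hM using fun j => exists_multiplication (hP.potential_bdd j)
  obtain ⟨A, hA⟩ := exists_linearPart (componentL P.D) (partialL P.D) M (mulI P.D) P.δ P.Ω P.k₀
  have hMi : ∀ j (f g : L2 P.D), HasIntegralEq (volume.restrict P.D)
      (fun x => P.V j x * (f x * conj (g x)).re) (inner ℝ (M j f) g) := fun j f g =>
    (hasIntegralEq_inner (M j f) g).congr (by
      filter_upwards [hM j f] with x hx
      rw [hx, mul_assoc, Complex.re_ofReal_mul])
  have hKi : ∀ (f g : L2 P.D), HasIntegralEq (volume.restrict P.D)
      (fun x => (Complex.I * f x * conj (g x)).re) (inner ℝ (mulI P.D f) g) := fun f g =>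
    (hasIntegralEq_inner (mulI P.D f) g).congr (by
      filter_upwards [Lp.coeFn_smul Complex.I f] with x hx
      rw [mulI_apply, hx, Pi.smul_apply, smul_eq_mul])
  have hMs : ∀ j (f g : L2 P.D), inner ℝ (M j f) g = inner ℝ (M j g) f := fun j f g => by
    rw [← (hMi j f g).2, ← (hMi j g f).2]
    congr 1 with x
    simp only [Complex.mul_re, Complex.conj_re, Complex.conj_im]
    ring
  -- `M j` is constructed as a real-linear map only; its commutation with `i` comes from the
  -- pointwise formula.
  have hMI : ∀ j (f : L2 P.D), M j (Complex.I • f) = Complex.I • M j f := fun j f => by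
    refine Lp.ext ?_
    filter_upwards [hM j (Complex.I • f), Lp.coeFn_smul Complex.I f,
      Lp.coeFn_smul Complex.I (M j f), hM j f] with x h1 h2 h3 h4
    rw [h1, h2, h3, Pi.smul_apply, Pi.smul_apply, h4, smul_eq_mul, smul_eq_mul]
    ring
  -- The value left as `_` is assembled with the bracketing of `exists_linearPart`, so that it
  -- matches the right-hand side of `hA`.
  have hlin : ∀ v w, HasIntegralEq (volume.restrict P.D) (fun x =>
      ((∑ j, (1 / 2 * ∑ i, (pd i v j x * conj (pd i w j x)).re
        + P.V j x * (comp v j x * conj (comp w j x)).re)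
      + P.δ / 2 * ((comp v 0 x * conj (comp w 0 x)).re - (comp v 1 x * conj (comp w 1 x)).re))
      + P.Ω / 2 * ((comp v 0 x * conj (comp w 1 x)).re + (comp v 1 x * conj (comp w 0 x)).re)))
      _ := fun v w =>
    (((HasIntegralEq.sum Finset.univ fun j =>
      ((HasIntegralEq.sum Finset.univ fun i =>
        hasIntegralEq_inner (partialL P.D i j v) (partialL P.D i j w)).const_mul (1 / 2)).add
          (hMi j (componentL P.D j v) (componentL P.D j w))).add
      (((hasIntegralEq_inner (componentL P.D 0 v) (componentL P.D 0 w)).sub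
        (hasIntegralEq_inner (componentL P.D 1 v) (componentL P.D 1 w))).const_mul (P.δ / 2))).add
      (((hasIntegralEq_inner (componentL P.D 0 v) (componentL P.D 1 w)).add
        (hasIntegralEq_inner (componentL P.D 1 v) (componentL P.D 0 w))).const_mul (P.Ω / 2)))
  have hspin : ∀ v w, HasIntegralEq (volume.restrict P.D) (fun x =>
      P.k₀ * ((Complex.I * pd 0 v 0 x * conj (comp w 0 x)).re
        - (Complex.I * pd 0 v 1 x * conj (comp w 1 x)).re)) _ := fun v w =>
    (((hKi (partialL P.D 0 0 v) (componentL P.D 0 w)).sub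
      (hKi (partialL P.D 0 1 v) (componentL P.D 1 w))).const_mul P.k₀)
  have espin : ∀ (k : ℝ) (a b p q : ℂ), (Complex.I * k * (conj a * p - conj b * q)).re =
      k * ((Complex.I * p * conj a).re - (Complex.I * q * conj b).re) := fun k a b p q => by
    rw [← Complex.sub_re, ← Complex.re_ofReal_mul]
    congr 1
    ring
  have e2 : ∀ z : ℂ, (1 / 2 * z).re = 1 / 2 * z.re := fun z => by simp
  have e3 : ∀ (r : ℝ) (z : ℂ), (r / 2 * z).re = r / 2 * z.re := fun r z => by
    rw [← Complex.re_ofReal_mul]; norm_num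
  have en : ∀ z : ℂ, (z * conj z).re = ‖z‖ ^ 2 := fun z => by
    rw [Complex.mul_conj, Complex.ofReal_re, Complex.normSq_eq_norm_sq]
  refine ⟨A, fun v w => ?_, fun v w => ?_, fun v w => ?_, fun v => ?_⟩
  · rw [hA, hA]
    simp only [hMs _ (componentL P.D _ v) (componentL P.D _ w), inner_mulI_partialL _ _ v w,
      fun T : H P.D →L[ℝ] L2 P.D => real_inner_comm (T v) (T w),
      fun T T' : H P.D →L[ℝ] L2 P.D => real_inner_comm (T v) (T' w)]
    ring
  · rw [hA, hA]
    simp only [componentL_I_smul, partialL_I_smul, hMI, mulI_apply, inner_I_smul]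
  · rw [hA, ← (hlin v w).2, ← (hspin v w).2]
    congr 1
    · congr 1 with x
      simp only [Complex.add_re, Complex.sub_re, Complex.re_sum, e2, e3, mul_assoc,
        Complex.re_ofReal_mul]
    · congr 1 with x
      exact (espin ..).symm
  · rw [hA]
    refine ((hlin v v).add (hspin v v)).congr (Eventually.of_forall fun x => ?_)
    -- On the diagonal the two `Ω/2` cross terms coincide and give the `Ω` of the energy.
    have hc : (comp v 1 x * conj (comp v 0 x)).re = (comp v 0 x * conj (comp v 1 x)).re := by
      simp only [Complex.mul_re, Complex.conj_re, Complex.conj_im]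
      ring
    simp only [espin, en, Fin.sum_univ_two, hc]
    ring

end LinearPart
-- The interaction and the spectral statement for multilinear data
section Interaction

/-- The interaction form on pairs of densities. -/
theorem exists_interaction (Z : Type*) [NormedAddCommGroup Z] [InnerProductSpace ℝ Z]
    (b₁₁ b₁₂ b₂₂ : ℝ) : ∃ G : Z × Z →L[ℝ] Z × Z →L[ℝ] ℝ, ∀ p q, G p q =
      b₁₁ * inner ℝ p.1 q.1 + b₂₂ * inner ℝ p.2 q.2 +
        b₁₂ * (inner ℝ p.2 q.1 + inner ℝ p.1 q.2) := by
  let f := ContinuousLinearMap.fst ℝ Z Z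
  let s := ContinuousLinearMap.snd ℝ Z Z
  let B (T T' : Z × Z →L[ℝ] Z) : Z × Z →L[ℝ] Z × Z →L[ℝ] ℝ := (innerSL ℝ).bilinearComp T T'
  exact ⟨b₁₁ • B f f + b₂₂ • B s s + b₁₂ • (B s f + B f s), fun p q => rfl⟩

/-- A pair of bilinear maps as a bilinear map into the product. -/
theorem exists_bilinear_prod {X Y Z : Type*} [NormedAddCommGroup X] [NormedSpace ℝ X]
    [NormedAddCommGroup Y] [NormedSpace ℝ Y] [NormedAddCommGroup Z] [NormedSpace ℝ Z]
    (f : X →L[ℝ] X →L[ℝ] Y) (g : X →L[ℝ] X →L[ℝ] Z) :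
    ∃ R : X →L[ℝ] X →L[ℝ] Y × Z, ∀ v w, R v w = (f v w, g v w) :=
  ⟨ContinuousLinearMap.compL ℝ X Y (Y × Z) (ContinuousLinearMap.inl ℝ Y Z) ∘L f +
    ContinuousLinearMap.compL ℝ X Z (Y × Z) (ContinuousLinearMap.inr ℝ Y Z) ∘L g,
    fun v w => by simp⟩

/-- The spectral statement for operators given by multilinear maps that are invariant under `K`. -/
theorem multiplicity_two_of_multilinear {X Y : Type*} [NormedAddCommGroup X] [NormedSpace ℝ X]
    [NormedAddCommGroup Y] [NormedSpace ℝ Y] {A S : X →L[ℝ] X →L[ℝ] ℝ} {R : X →L[ℝ] X →L[ℝ] Y}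
    {G : Y →L[ℝ] Y →L[ℝ] ℝ} {K : X → X} (hA : ∀ v w, A v w = A w v) (hR : ∀ v w, R v w = R w v)
    (hG : ∀ p q, G p q = G q p) (hS : ∀ v w, S v w = S w v)
    (hAK : ∀ v w, A (K v) w = -A v (K w)) (hRK : ∀ v w, R (K v) w = -R v (K w))
    (hSK : ∀ v w, S (K v) w = -S v (K w)) (hKK : ∀ v w, S (K v) (K w) = S v w)
    {E : X → ℝ} (hE : ∀ z, E z = 1 / 2 * A z z + 1 / 4 * G (R z z) (R z z))
    {T : X → StrongDual ℝ X} (hT : ∀ z w, T z w = A z w + (S z z)⁻¹ * G (R z z) (R z w))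
    {I : X →ₗ[ℝ] StrongDual ℝ X} (hI : ∀ v w, I v w = S v w) {u : X} {lam : ℝ} (huu : S u u = 1)
    (hEu : ∀ v, fderiv ℝ E u v = lam * S u v)
    (hpos : ∀ v, S u v = 0 → S (K u) v = 0 → v ≠ 0 →
      0 < fderiv ℝ (fderiv ℝ E) u v v - lam * S v v) :
    eigenspace (fderiv ℝ T u : X →ₗ[ℝ] StrongDual ℝ X) I lam = Submodule.span ℝ {u, K u} ∧
      geometricMultiplicity (fderiv ℝ T u : X →ₗ[ℝ] StrongDual ℝ X) I lam = 2 ∧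
      ¬ HasJordanChain (fderiv ℝ T u : X →ₗ[ℝ] StrongDual ℝ X) I lam ∧
      algebraicMultiplicity (fderiv ℝ T u : X →ₗ[ℝ] StrongDual ℝ X) I lam = 2 := by
  -- Symmetry and skewness under `K` together make `S u (K u)` its own negative; the same holds for
  -- `R u (K u)`. A phase rotation changes the densities only to second order along the tangent
  -- line.
  have huK : S u (K u) = 0 := by
    have := hSK u u
    rw [hS] at this
    linarith
  have hRuK : R u (K u) = 0 := by
    have h := hRK u u
    rw [hR, eq_neg_iff_add_eq_zero, ← two_smul ℝ] at h
    exact (smul_eq_zero.1 h).resolve_left two_ne_zero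
  obtain ⟨hJ, hH⟩ := exists_derivatives hA hR hG hS huu
  have eT : T = fun z => A z + (S z z)⁻¹ • (G (R z z)).comp (R z) := by
    funext z
    ext w
    exact hT z w
  have eE : E = fun z => 1 / 2 * A z z + 1 / 4 * G (R z z) (R z z) := funext hE
  rw [← eT] at hJ
  rw [← eE] at hH
  have hu : ∀ w, A u w + G (R u u) (R u w) = lam * S u w := fun w => by
    rw [← hEu w, eE, (hasFDerivAt_quartic hA hR hG u).fderiv]
    rfl
  have hsub : ∀ v w, ((fderiv ℝ T u : X →ₗ[ℝ] StrongDual ℝ X) - lam • I) v w =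
      A v w + (2 * G (R u v) (R u w) + G (R u u) (R v w))
        - 2 * S u v * G (R u u) (R u w) - lam * S v w := fun v w => by
    rw [← hJ, ← hI v w]
    rfl
  refine multiplicity_two (fun v w => by rw [hI, hI, hS]) (by rw [hI, huu])
    (by rw [hI, hKK, huu]) (by rw [hI, huK]) ?_ ?_ fun v h1 h2 hv => ?_
  -- At `v = u` the cubic terms have coefficients 2 + 1 - 2 = 1, which is the Euler-Lagrange
  -- equation `hu`.
  · ext w
    rw [hsub, huu]
    have := hu w
    simp only [zero_apply]
    linarith
  -- Every term containing `S u (K u)` or `R u (K u)` drops out; moving `K` to the other argument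
  -- leaves `hu` tested with `K w`.
  · ext w
    rw [hsub, huK, hRuK, hAK, hRK, hSK]
    have := hu (K w)
    simp only [zero_apply, map_neg, map_zero]
    linarith
  -- For `S u v = 0` the normalization term vanishes, so the form is the Hessian minus `lam S`.
  · rw [hI] at h1 h2
    have h := hpos v h1 h2 hv
    rw [hH] at h
    rw [hsub, h1]
    linarith

/-- The interaction form with densities `ρ 0`, `ρ 1`. -/
noncomputable def interaction {X Z : Type*} [NormedAddCommGroup X] [NormedSpace ℝ X]
    [NormedAddCommGroup Z] [InnerProductSpace ℝ Z] (b₁₁ b₁₂ b₂₂ : ℝ)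
    (ρ : Fin 2 → X →L[ℝ] X →L[ℝ] Z) (u v w : X) : ℝ :=
  b₁₁ * inner ℝ (ρ 0 u u) (ρ 0 v w) + b₂₂ * inner ℝ (ρ 1 u u) (ρ 1 v w) +
    b₁₂ * (inner ℝ (ρ 1 u u) (ρ 0 v w) + inner ℝ (ρ 0 u u) (ρ 1 v w))

/-- `multiplicity_two_of_multilinear` for an interaction of two densities. -/
theorem multiplicity_two_of_densities {X Z : Type*} [NormedAddCommGroup X] [NormedSpace ℝ X]
    [NormedAddCommGroup Z] [InnerProductSpace ℝ Z] {A S : X →L[ℝ] X →L[ℝ] ℝ}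
    {ρ : Fin 2 → X →L[ℝ] X →L[ℝ] Z} {K : X → X} {b₁₁ b₁₂ b₂₂ : ℝ} (hA : ∀ v w, A v w = A w v)
    (hρ : ∀ j v w, ρ j v w = ρ j w v) (hS : ∀ v w, S v w = S w v)
    (hAK : ∀ v w, A (K v) w = -A v (K w)) (hρK : ∀ j v w, ρ j (K v) w = -ρ j v (K w))
    (hSK : ∀ v w, S (K v) w = -S v (K w)) (hKK : ∀ v w, S (K v) (K w) = S v w)
    {E : X → ℝ} (hE : ∀ z, E z = 1 / 2 * A z z + 1 / 4 * interaction b₁₁ b₁₂ b₂₂ ρ z z z)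
    {T : X → StrongDual ℝ X}
    (hT : ∀ z w, T z w = A z w + (S z z)⁻¹ * interaction b₁₁ b₁₂ b₂₂ ρ z z w)
    {I : X →ₗ[ℝ] StrongDual ℝ X} (hI : ∀ v w, I v w = S v w) {u : X} {lam : ℝ} (huu : S u u = 1)
    (hEu : ∀ v, fderiv ℝ E u v = lam * S u v)
    (hpos : ∀ v, S u v = 0 → S (K u) v = 0 → v ≠ 0 →
      0 < fderiv ℝ (fderiv ℝ E) u v v - lam * S v v) :
    eigenspace (fderiv ℝ T u : X →ₗ[ℝ] StrongDual ℝ X) I lam = Submodule.span ℝ {u, K u} ∧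
      geometricMultiplicity (fderiv ℝ T u : X →ₗ[ℝ] StrongDual ℝ X) I lam = 2 ∧
      ¬ HasJordanChain (fderiv ℝ T u : X →ₗ[ℝ] StrongDual ℝ X) I lam ∧
      algebraicMultiplicity (fderiv ℝ T u : X →ₗ[ℝ] StrongDual ℝ X) I lam = 2 := by
  obtain ⟨R, hR⟩ := exists_bilinear_prod (ρ 0) (ρ 1)
  obtain ⟨G, hG⟩ := exists_interaction Z b₁₁ b₁₂ b₂₂
  have hNG : ∀ u v w, interaction b₁₁ b₁₂ b₂₂ ρ u v w = G (R u u) (R v w) := fun u v w => by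
    rw [interaction, hG, hR, hR]
  refine multiplicity_two_of_multilinear (R := R) (G := G) hA (fun v w => ?_) (fun p q => ?_) hS hAK
    (fun v w => ?_) hSK hKK (fun z => by rw [hE, hNG]) (fun z w => by rw [hT, hNG]) hI huu hEu hpos
  · rw [hR, hR, hρ 0 v w, hρ 1 v w]
  · rw [hG, hG, real_inner_comm p.1, real_inner_comm p.2, real_inner_comm p.1 q.2,
      real_inner_comm p.2 q.1]
    ring
  · rw [hR, hR, hρK 0 v w, hρK 1 v w]
    rfl

variable {d : ℕ}

/-- Skewness under `i` is the pointwise identity `Re (i a conj b) = -Re (a conj (i b))`; it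
expresses that a common phase leaves the densities unchanged. -/
theorem exists_densities {P : Model d} (hP : P.Assumptions) :
    ∃ ρ : Fin 2 → H P.D →L[ℝ] H P.D →L[ℝ] Lp ℝ 2 (volume.restrict P.D),
      (∀ j v w, ρ j v w = ρ j w v) ∧
      (∀ j v w, ρ j (Complex.I • v) w = -ρ j v (Complex.I • w)) ∧
      ∀ j v w, ρ j v w =ᵐ[volume.restrict P.D] fun x => (comp v j x * conj (comp w j x)).re := by
  choose ρ hρ using exists_density hP.dim hP.bounded
  refine ⟨ρ, fun j v w => Lp.ext ?_, fun j v w => Lp.ext ?_, hρ⟩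
  · filter_upwards [hρ j v w, hρ j w v] with x h1 h2
    rw [h1, h2]
    simp only [Complex.mul_re, Complex.conj_re, Complex.conj_im]
    ring
  · filter_upwards [hρ j (Complex.I • v) w, hρ j v (Complex.I • w),
      Lp.coeFn_neg (ρ j v (Complex.I • w)), comp_I_smul v j, comp_I_smul w j] with x h1 h2 h3 h4 h5
    rw [h1, h3, Pi.neg_apply, h2, h4, h5]
    simp only [Complex.mul_re, Complex.mul_im, Complex.conj_re, Complex.conj_im, Complex.I_re,
      Complex.I_im]
    ring

theorem hasIntegralEq_inner_real {α : Type*} [MeasurableSpace α] {μ : Measure α} (f g : Lp ℝ 2 μ) :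
    HasIntegralEq μ (fun x => f x * g x) (inner ℝ f g) := by
  refine ⟨(L2.integrable_inner (𝕜 := ℝ) f g).congr (Eventually.of_forall fun x => ?_), ?_⟩
  · simp [mul_comm]
  · rw [L2.inner_def]
    exact integral_congr_ae (Eventually.of_forall fun x => by simp [mul_comm])

theorem re_mul_conj_self (z : ℂ) : (z * conj z).re = ‖z‖ ^ 2 := by
  rw [Complex.mul_conj, Complex.ofReal_re, Complex.normSq_eq_norm_sq]

/-- Each quartic term is an `L²` inner product of two densities, with `ρ j u u = |u_j|²`; hence its
integrability. -/
theorem hasIntegralEq_interaction (P : Model d)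
    {ρ : Fin 2 → H P.D →L[ℝ] H P.D →L[ℝ] Lp ℝ 2 (volume.restrict P.D)}
    (hρ : ∀ j v w, ρ j v w =ᵐ[volume.restrict P.D] fun x => (comp v j x * conj (comp w j x)).re)
    (u v w : H P.D) : HasIntegralEq (volume.restrict P.D) (fun x =>
      P.β₁₁ * (‖comp u 0 x‖ ^ 2 * (comp v 0 x * conj (comp w 0 x)).re)
        + P.β₂₂ * (‖comp u 1 x‖ ^ 2 * (comp v 1 x * conj (comp w 1 x)).re)
        + P.β₁₂ * (‖comp u 1 x‖ ^ 2 * (comp v 0 x * conj (comp w 0 x)).re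
          + ‖comp u 0 x‖ ^ 2 * (comp v 1 x * conj (comp w 1 x)).re))
      (interaction P.β₁₁ P.β₁₂ P.β₂₂ ρ u v w) := by
  refine ((((hasIntegralEq_inner_real _ _).const_mul _).add
    ((hasIntegralEq_inner_real _ _).const_mul _)).add
    (((hasIntegralEq_inner_real _ _).add (hasIntegralEq_inner_real _ _)).const_mul _)).congr ?_
  filter_upwards [hρ 0 u u, hρ 1 u u, hρ 0 v w, hρ 1 v w] with x h1 h2 h3 h4
  rw [h1, h2, h3, h4, re_mul_conj_self, re_mul_conj_self]

set_option maxHeartbeats 400000 in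
/-- The energy and the operators `A(z)` in terms of continuous multilinear maps that are symmetric
and invariant under multiplication by `i`. -/
theorem exists_multilinear_representation [NeZero d] {P : Model d} (hP : P.Assumptions) :
    ∃ (A : H P.D →L[ℝ] H P.D →L[ℝ] ℝ)
      (ρ : Fin 2 → H P.D →L[ℝ] H P.D →L[ℝ] Lp ℝ 2 (volume.restrict P.D)),
      (∀ v w, A v w = A w v) ∧ (∀ v w, A (Complex.I • v) (Complex.I • w) = A v w) ∧
      (∀ j v w, ρ j v w = ρ j w v) ∧
      (∀ j v w, ρ j (Complex.I • v) w = -ρ j v (Complex.I • w)) ∧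
      (∀ z, P.energy z = 1 / 2 * A z z + 1 / 4 * interaction P.β₁₁ P.β₁₂ P.β₂₂ ρ z z z) ∧
      ∀ u v w, P.formA u v w =
        A v w + (l2 u u)⁻¹ * interaction P.β₁₁ P.β₁₂ P.β₂₂ ρ u v w := by
  obtain ⟨A, hAs, hAI, hA, hAE⟩ := exists_operatorA_linear hP
  obtain ⟨ρ, hρs, hρI, hρ⟩ := exists_densities hP
  have hcub := hasIntegralEq_interaction P hρ
  refine ⟨A, ρ, hAs, hAI, hρs, hρI, fun z => ?_, fun u v w => ?_⟩
  -- On the diagonal `interaction` contains `β₁₂` twice, so half of it is the quartic density of the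
  -- energy; with the outer 1/2 this gives 1/4.
  · have h := ((hAE z).add ((hcub z z z).const_mul (1 / 2))).2
    rw [Model.energy, show 1 / 2 * A z z + 1 / 4 * interaction P.β₁₁ P.β₁₂ P.β₂₂ ρ z z z =
      1 / 2 * (A z z + 1 / 2 * interaction P.β₁₁ P.β₁₂ P.β₂₂ ρ z z z) by ring, ← h]
    congr 2 with x
    simp only [re_mul_conj_self]
    ring
  · rw [Model.formA, hA, ← ((hcub u v w).const_mul (l2 u u)⁻¹).2]
    congr 2 with x
    have e : ∀ (r s : ℝ) (z : ℂ), ((r : ℂ) / (s : ℂ) * z).re = s⁻¹ * (r * z.re) := by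
      intro r s z
      rw [← Complex.ofReal_div, Complex.re_ofReal_mul, div_eq_inv_mul, mul_assoc]
    simp only [Complex.add_re, mul_assoc, e, ← Complex.ofReal_pow, Complex.re_ofReal_mul]
    ring

end Interaction

/-! ### Conclusion for the condensate -/

theorem l2_self_of_mem_sphere {d : ℕ} {P : Model d} {u : H P.D} (hu : u ∈ P.sphere) :
    l2 u u = 1 := by
  rw [← show ∫ x in P.D, (‖comp u 0 x‖ ^ 2 + ‖comp u 1 x‖ ^ 2) = 1 from hu, l2]
  congr 1 with x
  simp only [Complex.mul_conj, Complex.normSq_eq_norm_sq, Complex.add_re, Complex.ofReal_re]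

end SOBEC

theorem lemma5p1 {d : ℕ} [NeZero d] (P : SOBEC.Model d) (hP : P.Assumptions)
    (u : SOBEC.H P.D) (lam : ℝ)
    (hmin : IsLocalMinOn P.energy P.sphere u) (heig : P.IsEigenpair u lam)
    (hiso : P.IsQuasiIsolated u lam) :
    SOBEC.eigenspace (SOBEC.Model.operatorJ hP u) (SOBEC.operatorI P.D) lam
        = Submodule.span ℝ {u, Complex.I • u} ∧
      SOBEC.geometricMultiplicity (SOBEC.Model.operatorJ hP u) (SOBEC.operatorI P.D) lam = 2 ∧
      ¬ SOBEC.HasJordanChain (SOBEC.Model.operatorJ hP u) (SOBEC.operatorI P.D) lam ∧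
      SOBEC.algebraicMultiplicity (SOBEC.Model.operatorJ hP u) (SOBEC.operatorI P.D) lam = 2 := by
  obtain ⟨A, ρ, hAs, hAI, hρs, hρI, hE, hform⟩ :=
    SOBEC.exists_multilinear_representation hP
  obtain ⟨S, hS⟩ := SOBEC.exists_l2_form P.D
  have hII : ∀ v : SOBEC.H P.D, Complex.I • Complex.I • v = -v := fun v => by
    rw [smul_smul, Complex.I_mul_I]
    exact neg_one_smul ℂ v
  have hSI : ∀ v w : SOBEC.H P.D, S (Complex.I • v) (Complex.I • w) = S v w :=
    fun v w => by rw [hS, hS, SOBEC.l2_I_smul]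
  -- Apply invariance to the pair `iv`, `w` and use `i² = -1`.
  have skew : ∀ B : SOBEC.H P.D →L[ℝ] SOBEC.H P.D →L[ℝ] ℝ,
      (∀ v w, B (Complex.I • v) (Complex.I • w) = B v w) →
      ∀ v w, B (Complex.I • v) w = -B v (Complex.I • w) := fun B hB v w => by
    rw [← hB, hII, map_neg, neg_apply]
  refine SOBEC.multiplicity_two_of_densities (T := fun z => SOBEC.Model.operatorA hP z z)
    (K := fun v => Complex.I • v) hAs hρs (fun v w => ?_) (skew A hAI) hρI (skew S hSI) hSI hE
    (fun z w => ?_) (fun v w => (hS v w).symm) ?_ (fun v => ?_) (fun v h1 h2 hv => ?_)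
  · rw [hS, hS, SOBEC.l2_comm]
  · rw [hS]
    exact hform z z w
  · rw [hS, SOBEC.l2_self_of_mem_sphere heig.1]
  · rw [hS, heig.2]
  · rw [hS] at h1 h2 ⊢
    exact hiso v ⟨h1, h2⟩ hv
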